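/- **Theorem 5.1.** Let $p\ge 2$. A *radial density* is a measurable $f:[0,\infty)\to[0,\infty)$ such that, with $c_{p,f}:=1/\int_{\mathbb R^p} f(\|y\|)\,dy$, for every symmetric positive definite $p\times p$ matrix $\Sigma$ the function $x\mapsto c_{p,f}(\det\Sigma)^{-1/2} f(\sqrt{x'\Sigma^{-1}x})$ is a probability density on $\mathbb R^p$ whose covariance matrix exists and equals $\Sigma$ (it suffices that this holds for $\Sigma=I_p$). Let $\mathcal F$ be the set of radial densities with finite fourth-order moments, that is, $\int_0^\infty r^{p+3}f(r)\,dr<\infty$, and let $\phi(r)=e^{-r^2/2}$ be the Gaussian radial density. Fix a unit vector $\theta_1^0\in\mathbb R^p$, $v>0$, a bounded sequence $(r_n)_{n\ge1}$ of positive real numbers, and $f\in\mathcal F$. For each $n$ let $X_{n1},\dots,X_{nn}$ be independent with common density $c_{p,f}(\det\Sigma_n)^{-1/2} f(\sqrt{x'\Sigma_n^{-1}x})$, where $\Sigma_n=I_p+r_n v\,\theta_1^0\theta_1^{0\prime}$; this hypothesis is denoted ${\rm P}_{\theta_1^0,r_n,v,f}$. Let $\bar X_n=\frac1n\sum_{i=1}^n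 X_{ni}$ and $S_n=\frac1n\sum_{i=1}^n(X_{ni}-\bar X_n)(X_{ni}-\bar X_n)'$, let $\hat\lambda_{n1}\ge\dots\ge\hat\lambda_{np}$ be the eigenvalues of $S_n$, and let $\hat\theta_{n1},\dots,\hat\theta_{np}$ be corresponding orthonormal eigenvectors, chosen arbitrarily. Let $\theta_1^0,\tilde\theta_{n2},\dots,\tilde\theta_{np}$ be the Gram–Schmidt orthonormalization of $\theta_1^0,\hat\theta_{n2},\dots,\hat\theta_{np}$, and put $$Q^{(n)}_{\rm HPV}=\frac{n}{\hat\lambda_{n1}}\sum_{j=2}^p\hat\lambda_{nj}^{-1}\big(\tilde\theta_{nj}'S_n\theta_1^0\big)^2,\qquad Q^{(n)\dagger}_{\rm HPV}=\frac{Q^{(n)}_{\rm HPV}}{1+\hat\kappa^{(n)}_p},$$ $$\hat\kappa_p^{(n)}=\frac{p\,\frac1n\sum_{i=1}^n d_{ni}^4}{(p+2)\big(\frac1n\sum_{i=1}^n d_{ni}^2\big)^2}-1,\qquad d_{ni}^2=(X_{ni}-\bar X_n)'S_n^{-1}(X_{ni}-\bar X_n)$$ (for $n>p$ these are well defined with probability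 one). Then, under ${\rm P}_{\theta_1^0,r_n,v,f}$, as $n\to\infty$, $$Q^{(n)\dagger}_{\rm HPV}\ \stackrel{\mathcal D}{\to}\ \chi^2_{p-1},$$ so that, writing $\chi^2_{p-1,1-\alpha}$ for the $\alpha$-upper quantile of $\chi^2_{p-1}$, for every $\alpha\in(0,1)$ the test rejecting when $Q^{(n)\dagger}_{\rm HPV}>\chi^2_{p-1,1-\alpha}$ satisfies $\Pr\big[Q^{(n)\dagger}_{\rm HPV}>\chi^2_{p-1,1-\alpha}\big]\to\alpha$. This holds for every bounded positive sequence $(r_n)$, in particular in each of the regimes (i) $r_n\equiv1$; (ii) $r_n\to0$ with $\sqrt n\,r_n\to\infty$; (iii) $r_n=1/\sqrt n$; (iv) $r_n=o(1/\sqrt n)$. Moreover, under the Gaussian hypothesis ${\rm P}_{\theta_1^0,r_n,v,\phi}$, $Q^{(n)\dagger}_{\rm HPV}-Q^{(n)}_{\rm HPV}\to0$ in probability, i.e. $Q^{(n)\dagger}_{\rm HPV}=Q^{(n)}_{\rm HPV}+o_{\rm P}(1)$. -/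

import Mathlib

open MeasureTheory ProbabilityTheory Filter Topology
open scoped Matrix ENNReal

noncomputable section

/-! ### Elliptical distributions on `ℝ^p` -/

/-- The Mahalanobis distance `√((x - μ)' Σ⁻¹ (x - μ))`. -/
def mahalanobis {p : ℕ} (μ : EuclideanSpace ℝ (Fin p)) (Sig : Matrix (Fin p) (Fin p) ℝ)
    (x : EuclideanSpace ℝ (Fin p)) : ℝ :=
  √((x - μ).ofLp ⬝ᵥ (Sig⁻¹ *ᵥ (x - μ).ofLp))

/-- The normalization factor `c_{p,f} = 1 / ∫_{ℝ^p} f(‖y‖) dy`. -/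
def normalizer (p : ℕ) (f : ℝ → ℝ) : ℝ :=
  (∫ y : EuclideanSpace ℝ (Fin p), f ‖y‖)⁻¹

/-- The elliptical distribution with location `μ`, covariance parameter `Σ` and radial density `f`:
the measure with Lebesgue density
`x ↦ c_{p,f} (det Σ)^{-1/2} f(√((x - μ)' Σ⁻¹ (x - μ)))`. -/
def ellipticalMeasure {p : ℕ} (μ : EuclideanSpace ℝ (Fin p)) (Sig : Matrix (Fin p) (Fin p) ℝ)
    (f : ℝ → ℝ) : Measure (EuclideanSpace ℝ (Fin p)) :=
  volume.withDensity fun x =>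
    ENNReal.ofReal (normalizer p f / √Sig.det * f (mahalanobis μ Sig x))

/-- The radial moment `μ_{ℓ,f} = ∫_0^∞ r^ℓ f(r) dr`, as an extended nonnegative number. -/
def radialMoment (l : ℕ) (f : ℝ → ℝ) : ℝ≥0∞ :=
  ∫⁻ r in Set.Ioi (0 : ℝ), ENNReal.ofReal (r ^ l * f r)

/-- `f : [0, ∞) → [0, ∞)` is a radial density on `ℝ^p`: the function above is a probability
density, and the resulting distribution has a covariance matrix, equal to the parameter `Σ`.
(The values of `f` on `(-∞, 0)` are never used. All the distributions with the same `f` are affine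
images of the one with `μ = 0` and `Σ = I_p`, so it is enough to ask this of the latter.) -/
structure IsRadialDensity (p : ℕ) (f : ℝ → ℝ) : Prop where
  measurable : Measurable f
  nonneg : ∀ r, 0 ≤ r → 0 ≤ f r
  isProbabilityMeasure :
    IsProbabilityMeasure (ellipticalMeasure (0 : EuclideanSpace ℝ (Fin p)) 1 f)
  memLp_two : ∀ i : Fin p, MemLp (fun x : EuclideanSpace ℝ (Fin p) => x i) 2
    (ellipticalMeasure (0 : EuclideanSpace ℝ (Fin p)) 1 f)
  covariance_eq : ∀ i j : Fin p,
    cov[fun x : EuclideanSpace ℝ (Fin p) => x i, fun x : EuclideanSpace ℝ (Fin p) => x j;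
      ellipticalMeasure (0 : EuclideanSpace ℝ (Fin p)) 1 f] = (1 : Matrix (Fin p) (Fin p) ℝ) i j

/-- The collection `ℱ` of radial densities with finite fourth-order moments, `μ_{p+3,f} < ∞`. -/
structure IsRadialDensityFour (p : ℕ) (f : ℝ → ℝ) : Prop extends IsRadialDensity p f where
  radialMoment_lt_top : radialMoment (p + 3) f < ∞

/-- The Gaussian radial density `φ(r) = exp(-r²/2)`. -/
def gaussianRadial (r : ℝ) : ℝ := Real.exp (-r ^ 2 / 2)

/-- The single-spiked covariance matrix `I_p + r v θ θ'`. -/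
def spikedCov {p : ℕ} (θ : EuclideanSpace ℝ (Fin p)) (r v : ℝ) : Matrix (Fin p) (Fin p) ℝ :=
  1 + (r * v) • Matrix.vecMulVec θ.ofLp θ.ofLp

/-- `Y_1, …, Y_n` are independent with common distribution `ν` under the probability measure `P`. -/
structure IsRandomSample {Ω : Type*} [MeasurableSpace Ω] {n p : ℕ} (P : Measure Ω)
    (Y : Fin n → Ω → EuclideanSpace ℝ (Fin p)) (ν : Measure (EuclideanSpace ℝ (Fin p))) :
    Prop where
  hasLaw : ∀ i, HasLaw (Y i) ν P
  indep : iIndepFun Y P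

/-! ### Sample quantities -/

/-- The sample average. -/
def sampleMean {n p : ℕ} (x : Fin n → EuclideanSpace ℝ (Fin p)) : EuclideanSpace ℝ (Fin p) :=
  (n : ℝ)⁻¹ • ∑ i, x i

/-- The sample covariance matrix `S = (1/n) ∑ (x_i - x̄)(x_i - x̄)'`. -/
def sampleCov {n p : ℕ} (x : Fin n → EuclideanSpace ℝ (Fin p)) : Matrix (Fin p) (Fin p) ℝ :=
  (n : ℝ)⁻¹ • ∑ i, Matrix.vecMulVec (x i - sampleMean x).ofLp (x i - sampleMean x).ofLp

/-- `lam` lists the eigenvalues of `S` in decreasing order (with multiplicity) and `θ j` is a unit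
eigenvector for `lam j`, the `θ j` being pairwise orthogonal. -/
structure IsEigensystem {p : ℕ} (S : Matrix (Fin p) (Fin p) ℝ) (lam : Fin p → ℝ)
    (θ : Fin p → EuclideanSpace ℝ (Fin p)) : Prop where
  antitone : Antitone lam
  orthonormal : Orthonormal ℝ θ
  mulVec_eq : ∀ j, S *ᵥ (θ j).ofLp = lam j • (θ j).ofLp

theorem sampleCov_isHermitian {n p : ℕ} (x : Fin n → EuclideanSpace ℝ (Fin p)) :
    (sampleCov x).IsHermitian := by
  ext i j
  simp [sampleCov, Matrix.sum_apply, Matrix.vecMulVec_apply, mul_comm]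

/-- Every sample covariance matrix has such a system of eigenvalues and eigenvectors. -/
theorem exists_isEigensystem {n p : ℕ} (x : Fin n → EuclideanSpace ℝ (Fin p)) :
    ∃ lam θ, IsEigensystem (sampleCov x) lam θ := by
  have hc : Module.finrank ℝ (EuclideanSpace ℝ (Fin p)) = p := by simp
  have hs := Matrix.isSymmetric_toEuclideanLin_iff.mpr (sampleCov_isHermitian x)
  refine ⟨hs.eigenvalues hc, hs.eigenvectorBasis hc, hs.eigenvalues_antitone hc,
    (hs.eigenvectorBasis hc).orthonormal, fun j => ?_⟩
  have h := congrArg WithLp.ofLp (hs.apply_eigenvectorBasis hc j)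
  rw [Matrix.toLpLin_apply] at h
  exact h

/-- `θ̃_1 = θ₀, θ̃_2, …, θ̃_p`: the (normalized) Gram-Schmidt orthogonalization of
`θ₀, θ̂_2, …, θ̂_p` (indices are shifted: the index `0 : Fin p` stands for `1`). -/
def thetaTilde {p : ℕ} [NeZero p] (θ₀ : EuclideanSpace ℝ (Fin p))
    (θ : Fin p → EuclideanSpace ℝ (Fin p)) : Fin p → EuclideanSpace ℝ (Fin p) :=
  InnerProductSpace.gramSchmidtNormed ℝ (Function.update θ 0 θ₀)

/-- The statistic `Q_HPV = (n / λ̂_1) ∑_{j=2}^p λ̂_j⁻¹ (θ̃_j' S θ₀)²` computed on the sample `x`, from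
the eigenvalues `lam` and eigenvectors `θ` of its covariance matrix. -/
def qHPV {n p : ℕ} [NeZero p] (θ₀ : EuclideanSpace ℝ (Fin p))
    (x : Fin n → EuclideanSpace ℝ (Fin p)) (lam : Fin p → ℝ)
    (θ : Fin p → EuclideanSpace ℝ (Fin p)) : ℝ :=
  n / lam 0 * ∑ j ∈ Finset.univ.erase (0 : Fin p),
    (lam j)⁻¹ * ((thetaTilde θ₀ θ j).ofLp ⬝ᵥ (sampleCov x *ᵥ θ₀.ofLp)) ^ 2

/-- The squared sample Mahalanobis distance `(x_i - x̄)' S⁻¹ (x_i - x̄)`. -/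
def sampleSqDist {n p : ℕ} (x : Fin n → EuclideanSpace ℝ (Fin p)) (i : Fin n) : ℝ :=
  (x i - sampleMean x).ofLp ⬝ᵥ ((sampleCov x)⁻¹ *ᵥ (x i - sampleMean x).ofLp)

/-- The sample elliptical kurtosis `κ̂_p`. -/
def kurtosisHat {n p : ℕ} (x : Fin n → EuclideanSpace ℝ (Fin p)) : ℝ :=
  (p * ((n : ℝ)⁻¹ * ∑ i, sampleSqDist x i ^ 2)) /
    ((p + 2) * ((n : ℝ)⁻¹ * ∑ i, sampleSqDist x i) ^ 2) - 1

/-- The kurtosis-corrected statistic `Q_HPV† = Q_HPV / (1 + κ̂_p)`. -/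
def qHPVDagger {n p : ℕ} [NeZero p] (θ₀ : EuclideanSpace ℝ (Fin p))
    (x : Fin n → EuclideanSpace ℝ (Fin p)) (lam : Fin p → ℝ)
    (θ : Fin p → EuclideanSpace ℝ (Fin p)) : ℝ :=
  qHPV θ₀ x lam θ / (1 + kurtosisHat x)

/-! ### The chi-square distribution -/

/-- The chi-square distribution with `k` degrees of freedom: the law of `Z_1² + ⋯ + Z_k²` for
independent standard normal `Z_1, …, Z_k`. -/
def chiSquare (k : ℕ) : Measure ℝ :=
  (Measure.pi fun _ : Fin k => gaussianReal 0 1).map fun z => ∑ i, z i ^ 2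

instance (k : ℕ) : IsProbabilityMeasure (chiSquare k) :=
  Measure.isProbabilityMeasure_map
    (Measurable.aemeasurable (Finset.measurable_fun_sum _ fun i _ => by fun_prop))

/-- The `α`-upper quantile `χ²_{k,1-α}` of the chi-square distribution. -/
def chiSquareUpperQuantile (k : ℕ) (α : ℝ) : ℝ :=
  sInf {t : ℝ | 1 - α ≤ cdf (chiSquare k) t}

end

noncomputable section

/-! ### Partial sums of squared coefficients along a Gram-Schmidt basis -/

section GramSchmidt

variable {E : Type*} [NormedAddCommGroup E] [InnerProductSpace ℝ E] {p : ℕ}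

open InnerProductSpace

theorem span_gramSchmidtNormed_of_isLowerSet (f : Fin p → E) {s : Set (Fin p)}
    (hs : IsLowerSet s) :
    Submodule.span ℝ (gramSchmidtNormed ℝ f '' s) = Submodule.span ℝ (f '' s) := by
  rw [span_gramSchmidtNormed]
  refine Submodule.span_eq_span ?_ ?_
  · rintro _ ⟨i, hi, rfl⟩
    exact Submodule.span_mono (Set.image_mono (fun j hj => hs hj hi))
      (gramSchmidt_mem_span ℝ f (le_refl i))
  · rintro _ ⟨i, hi, rfl⟩
    exact Submodule.span_mono (Set.image_mono (fun j hj => hs hj hi))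
      (mem_span_gramSchmidt ℝ f (le_refl i))

theorem inner_gramSchmidtNormed_of_ne (f : Fin p → E) {i j : Fin p} (h : i ≠ j) :
    inner ℝ (gramSchmidtNormed ℝ f i) (gramSchmidtNormed ℝ f j) = 0 := by
  simp [gramSchmidtNormed, inner_smul_left, inner_smul_right, gramSchmidt_orthogonal ℝ f h]

/-- Partial sums of squared coefficients only depend on the spanned subspace. -/
theorem sum_sq_inner_gramSchmidtNormed [FiniteDimensional ℝ E] (f : Fin p → E) {s : Finset (Fin p)}
    (hs : IsLowerSet (s : Set (Fin p))) (w : E) :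
    ∑ i ∈ s, inner ℝ (gramSchmidtNormed ℝ f i) w ^ 2
      = inner ℝ ((Submodule.span ℝ (f '' s)).starProjection w) w := by
  have h : (Submodule.span ℝ (f '' s)).starProjection w
      = ∑ i ∈ s, inner ℝ (gramSchmidtNormed ℝ f i) w • gramSchmidtNormed ℝ f i := by
    rw [← span_gramSchmidtNormed_of_isLowerSet f hs]
    refine Submodule.eq_starProjection_of_mem_orthogonal ?_ ?_
    · exact Submodule.sum_mem _ fun i hi => Submodule.smul_mem _ _
        (Submodule.subset_span ⟨i, hi, rfl⟩)
    · rw [Submodule.mem_orthogonal]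
      intro u hu
      induction hu using Submodule.span_induction with
      | mem x hx =>
        obtain ⟨k, hk, rfl⟩ := hx
        rw [inner_sub_right, inner_sum, Finset.sum_eq_single_of_mem k hk]
        · by_cases h0 : gramSchmidtNormed ℝ f k = 0
          · simp [h0]
          · rw [inner_smul_right, real_inner_self_eq_norm_sq, gramSchmidtNormed_unit_length' h0]
            simp
        · intro j _ hj
          rw [inner_smul_right, inner_gramSchmidtNormed_of_ne f hj.symm, mul_zero]
      | zero => simp
      | add x y _ _ hx hy => rw [inner_add_left, hx, hy, add_zero]
      | smul c x _ hx => rw [inner_smul_left, hx, mul_zero]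
  rw [h, sum_inner]
  exact Finset.sum_congr rfl fun i _ => by rw [real_inner_smul_left, sq]

end GramSchmidt

/-! ### Eigensystems -/

theorem dotProduct_ofLp {ι : Type*} [Fintype ι] (x y : EuclideanSpace ℝ ι) :
    x.ofLp ⬝ᵥ y.ofLp = inner ℝ x y := by
  rw [EuclideanSpace.inner_eq_star_dotProduct, dotProduct_comm]
  simp

theorem dotProduct_mulVec_ofLp {ι : Type*} [Fintype ι] [DecidableEq ι]
    (S : Matrix ι ι ℝ) (x y : EuclideanSpace ℝ ι) :
    x.ofLp ⬝ᵥ (S *ᵥ y.ofLp) = inner ℝ x (S.toEuclideanLin y) := by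
  rw [← dotProduct_ofLp]
  simp

namespace IsEigensystem

variable {p : ℕ} {S : Matrix (Fin p) (Fin p) ℝ} {lam : Fin p → ℝ}
  {θ : Fin p → EuclideanSpace ℝ (Fin p)}

/-- The orthonormal basis of eigenvectors. -/
def basis (h : IsEigensystem S lam θ) : OrthonormalBasis (Fin p) ℝ (EuclideanSpace ℝ (Fin p)) :=
  OrthonormalBasis.mk h.orthonormal
    (h.orthonormal.linearIndependent.span_eq_top_of_card_eq_finrank' (by simp)).ge

theorem coe_basis (h : IsEigensystem S lam θ) : ⇑h.basis = θ := by simp [basis]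

theorem toEuclideanLin_apply (h : IsEigensystem S lam θ) (j : Fin p) :
    S.toEuclideanLin (θ j) = lam j • θ j := by
  apply WithLp.ofLp_injective 2
  simpa using h.mulVec_eq j

theorem sum_inner_smul (h : IsEigensystem S lam θ) (x : EuclideanSpace ℝ (Fin p)) :
    ∑ j, inner ℝ (θ j) x • θ j = x := by
  simpa [h.coe_basis] using h.basis.sum_repr' x

theorem apply_eq_sum (h : IsEigensystem S lam θ) (x : EuclideanSpace ℝ (Fin p)) :
    S.toEuclideanLin x = ∑ j, (lam j * inner ℝ (θ j) x) • θ j := by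
  conv_lhs => rw [← h.sum_inner_smul x]
  rw [map_sum]
  refine Finset.sum_congr rfl fun j _ => ?_
  rw [map_smul, h.toEuclideanLin_apply, smul_smul, mul_comm]

theorem inner_apply (h : IsEigensystem S lam θ) (j : Fin p) (x : EuclideanSpace ℝ (Fin p)) :
    inner ℝ (θ j) (S.toEuclideanLin x) = lam j * inner ℝ (θ j) x := by
  rw [h.apply_eq_sum]
  have := h.orthonormal.inner_right_fintype (fun j => lam j * inner ℝ (θ j) x) j
  simpa using this

theorem inner_eq_zero_of_ne {lam' : Fin p → ℝ} {θ' : Fin p → EuclideanSpace ℝ (Fin p)}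
    (h : IsEigensystem S lam θ) (h' : IsEigensystem S lam' θ') {i j : Fin p}
    (hij : lam i ≠ lam' j) : inner ℝ (θ i) (θ' j) = 0 := by
  have h1 := h.inner_apply i (θ' j)
  rw [h'.toEuclideanLin_apply, inner_smul_right] at h1
  have h2 : (lam i - lam' j) * inner ℝ (θ i) (θ' j) = 0 := by linarith
  exact (mul_eq_zero.1 h2).resolve_left (sub_ne_zero.2 hij)

theorem norm_eq_one (h : IsEigensystem S lam θ) (j : Fin p) : ‖θ j‖ = 1 := h.orthonormal.1 j

theorem inner_apply_self (h : IsEigensystem S lam θ) (j : Fin p) :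
    inner ℝ (θ j) (S.toEuclideanLin (θ j)) = lam j := by
  rw [h.inner_apply, real_inner_self_eq_norm_sq, h.norm_eq_one]; simp

theorem inner_self_apply_eq_sum (h : IsEigensystem S lam θ) (x : EuclideanSpace ℝ (Fin p)) :
    inner ℝ x (S.toEuclideanLin x) = ∑ j, lam j * inner ℝ (θ j) x ^ 2 := by
  rw [h.apply_eq_sum, inner_sum]
  refine Finset.sum_congr rfl fun j _ => ?_
  rw [inner_smul_right, real_inner_comm]; ring

theorem sum_sq_inner (h : IsEigensystem S lam θ) (x : EuclideanSpace ℝ (Fin p)) :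
    ∑ j, inner ℝ (θ j) x ^ 2 = ‖x‖ ^ 2 := by
  simpa [h.coe_basis] using h.basis.sum_sq_inner_right x

theorem inner_self_apply_le [NeZero p] (h : IsEigensystem S lam θ) (x : EuclideanSpace ℝ (Fin p)) :
    inner ℝ x (S.toEuclideanLin x) ≤ lam 0 * ‖x‖ ^ 2 := by
  rw [h.inner_self_apply_eq_sum, ← h.sum_sq_inner x, Finset.mul_sum]
  exact Finset.sum_le_sum fun j _ =>
    mul_le_mul_of_nonneg_right (h.antitone (Fin.zero_le j)) (sq_nonneg _)

theorem le_lam {lam' : Fin p → ℝ} {θ' : Fin p → EuclideanSpace ℝ (Fin p)}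
    (h : IsEigensystem S lam θ) (h' : IsEigensystem S lam' θ') (k : Fin p) :
    lam' k ≤ lam k := by
  by_contra! hlt
  let v : {i : Fin p // i ≤ k} ⊕ {j : Fin p // k ≤ j} → EuclideanSpace ℝ (Fin p) :=
    Sum.elim (fun i => θ' i) (fun j => θ j)
  have hv : Orthonormal ℝ v := by
    have hne : ∀ (i : {i : Fin p // i ≤ k}) (j : {j : Fin p // k ≤ j}),
        inner ℝ (θ j) (θ' i) = 0 := fun i j =>
      h.inner_eq_zero_of_ne h' ((h.antitone j.2).trans_lt (hlt.trans_le (h'.antitone i.2))).ne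
    refine ⟨?_, ?_⟩
    · rintro (i | j)
      · exact h'.norm_eq_one i
      · exact h.norm_eq_one j
    · rintro (i | i) (j | j) hij
      · exact h'.orthonormal.2 (fun e => hij (congrArg Sum.inl (Subtype.ext e)))
      · exact (real_inner_comm _ _).trans (hne i j)
      · exact hne j i
      · exact h.orthonormal.2 (fun e => hij (congrArg Sum.inr (Subtype.ext e)))
  have hc := hv.linearIndependent.fintype_card_le_finrank
  have h1 : Fintype.card {i : Fin p // i ≤ k} = k + 1 := by
    rw [Fintype.card_subtype, ← Fin.card_Iic]; congr 1; ext; simp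
  have h2 : Fintype.card {j : Fin p // k ≤ j} = p - k := by
    rw [Fintype.card_subtype, ← Fin.card_Ici]; congr 1; ext; simp
  rw [Fintype.card_sum, h1, h2] at hc
  simp only [finrank_euclideanSpace, Fintype.card_fin] at hc
  have := k.2
  omega

theorem lam_unique {lam' : Fin p → ℝ} {θ' : Fin p → EuclideanSpace ℝ (Fin p)}
    (h : IsEigensystem S lam θ) (h' : IsEigensystem S lam' θ') : lam = lam' :=
  funext fun k => le_antisymm (h'.le_lam h k) (h.le_lam h' k)

end IsEigensystem

/-! ### The statistic does not depend on the choice of eigenvectors -/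

theorem thetaTilde_zero {p : ℕ} [NeZero p] {θ₀ : EuclideanSpace ℝ (Fin p)} (hθ₀ : ‖θ₀‖ = 1)
    (θ : Fin p → EuclideanSpace ℝ (Fin p)) : thetaTilde θ₀ θ 0 = θ₀ := by
  have h : InnerProductSpace.gramSchmidt ℝ (Function.update θ 0 θ₀) 0 = θ₀ := by
    rw [InnerProductSpace.gramSchmidt_def]
    have : Finset.Iio (0 : Fin p) = ∅ := by
      ext j; simp
    simp [this]
  rw [thetaTilde, InnerProductSpace.gramSchmidtNormed, h]
  simp [hθ₀]

theorem qHPV_eq {n p : ℕ} [NeZero p] (θ₀ : EuclideanSpace ℝ (Fin p))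
    (x : Fin n → EuclideanSpace ℝ (Fin p)) (lam : Fin p → ℝ)
    (θ : Fin p → EuclideanSpace ℝ (Fin p)) :
    qHPV θ₀ x lam θ = n / lam 0 * ∑ j ∈ Finset.univ.erase (0 : Fin p),
      (lam j)⁻¹ * inner ℝ (thetaTilde θ₀ θ j) ((sampleCov x).toEuclideanLin θ₀) ^ 2 := by
  simp only [qHPV, dotProduct_mulVec_ofLp]

namespace IsEigensystem

variable {p : ℕ} [NeZero p] {S : Matrix (Fin p) (Fin p) ℝ} {lam : Fin p → ℝ}
  {θ : Fin p → EuclideanSpace ℝ (Fin p)}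

theorem sum_sq_inner_thetaTilde (h : IsEigensystem S lam θ) {θ₀ : EuclideanSpace ℝ (Fin p)}
    (hθ₀ : ‖θ₀‖ = 1) :
    ∑ j ∈ Finset.univ.erase (0 : Fin p),
        inner ℝ (thetaTilde θ₀ θ j) (S.toEuclideanLin θ₀) ^ 2
      = ‖S.toEuclideanLin θ₀‖ ^ 2 - inner ℝ θ₀ (S.toEuclideanLin θ₀) ^ 2 := by
  have hall := sum_sq_inner_gramSchmidtNormed (Function.update θ 0 θ₀)
    (s := Finset.univ) (by simpa using isLowerSet_univ) (S.toEuclideanLin θ₀)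
  have hmem : S.toEuclideanLin θ₀ ∈ Submodule.span ℝ
      (Function.update θ 0 θ₀ '' ((Finset.univ : Finset (Fin p)) : Set (Fin p))) := by
    have e : S.toEuclideanLin θ₀
        = lam 0 • θ₀ + ∑ j, ((lam j - lam 0) * inner ℝ (θ j) θ₀) • θ j := by
      conv_rhs => enter [1]; rw [← h.sum_inner_smul θ₀, Finset.smul_sum]
      rw [h.apply_eq_sum, ← Finset.sum_add_distrib]
      refine Finset.sum_congr rfl fun j _ => ?_
      rw [smul_smul, ← add_smul]; ring_nf
    rw [e]
    refine Submodule.add_mem _ (Submodule.smul_mem _ _ (Submodule.subset_span ⟨0, by simp⟩))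
      (Submodule.sum_mem _ fun j _ => ?_)
    by_cases hj : j = 0
    · simp [hj]
    · exact Submodule.smul_mem _ _ (Submodule.subset_span ⟨j, by simp [hj]⟩)
  rw [Submodule.starProjection_eq_self_iff.2 hmem, real_inner_self_eq_norm_sq,
    ← Finset.add_sum_erase _ _ (Finset.mem_univ (0 : Fin p))] at hall
  have h0 := thetaTilde_zero hθ₀ θ
  rw [thetaTilde] at h0
  rw [h0] at hall
  rw [← hall, thetaTilde]; ring

theorem span_update_eq {θ' : Fin p → EuclideanSpace ℝ (Fin p)} (h : IsEigensystem S lam θ)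
    (h' : IsEigensystem S lam θ') (hlam : ∀ j, j ≠ 0 → lam j ≠ lam 0)
    (θ₀ : EuclideanSpace ℝ (Fin p)) {s : Set (Fin p)} (hs : ∀ i j, lam i = lam j → i ∈ s → j ∈ s) :
    Submodule.span ℝ (Function.update θ 0 θ₀ '' s)
      = Submodule.span ℝ (Function.update θ' 0 θ₀ '' s) := by
  have key : ∀ {θ θ' : Fin p → EuclideanSpace ℝ (Fin p)}, IsEigensystem S lam θ →
      IsEigensystem S lam θ' → Submodule.span ℝ (Function.update θ 0 θ₀ '' s)
        ≤ Submodule.span ℝ (Function.update θ' 0 θ₀ '' s) := by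
    intro θ θ' h h'
    rw [Submodule.span_le]
    rintro _ ⟨j, hj, rfl⟩
    by_cases hj0 : j = 0
    · subst hj0
      exact Submodule.subset_span ⟨0, hj, by simp⟩
    · rw [Function.update_of_ne hj0, SetLike.mem_coe, ← h'.sum_inner_smul (θ j)]
      refine Submodule.sum_mem _ fun i _ => ?_
      by_cases hij : lam i = lam j
      · have hi0 : i ≠ 0 := by
          rintro rfl
          exact hlam j hj0 hij.symm
        exact Submodule.smul_mem _ _
          (Submodule.subset_span ⟨i, hs j i hij.symm hj, by simp [hi0]⟩)
      · rw [h'.inner_eq_zero_of_ne h hij, zero_smul]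
        exact Submodule.zero_mem _
  exact le_antisymm (key h h') (key h' h)

theorem sum_sq_inner_thetaTilde_unique {θ' : Fin p → EuclideanSpace ℝ (Fin p)}
    (h : IsEigensystem S lam θ) (h' : IsEigensystem S lam θ')
    (hlam : ∀ j, j ≠ 0 → lam j ≠ lam 0) (θ₀ w : EuclideanSpace ℝ (Fin p)) (c : ℝ) :
    ∑ j with lam j = c, inner ℝ (thetaTilde θ₀ θ j) w ^ 2
      = ∑ j with lam j = c, inner ℝ (thetaTilde θ₀ θ' j) w ^ 2 := by
  have hsplit : ∀ F : Fin p → ℝ, ∑ j with lam j = c, F j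
      = ∑ j with c ≤ lam j, F j - ∑ j with c < lam j, F j := by
    intro F
    rw [eq_sub_iff_add_eq, ← Finset.sum_union]
    · congr 1
      ext j
      simp only [Finset.mem_union, Finset.mem_filter, Finset.mem_univ, true_and]
      rw [le_iff_eq_or_lt, eq_comm]
    · rw [Finset.disjoint_filter]
      rintro j _ h1 h2
      exact h2.ne' h1
  have h1 : ∀ s : Finset (Fin p), IsLowerSet (s : Set (Fin p)) →
      (∀ i j, lam i = lam j → i ∈ s → j ∈ s) →
      ∑ j ∈ s, inner ℝ (thetaTilde θ₀ θ j) w ^ 2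
        = ∑ j ∈ s, inner ℝ (thetaTilde θ₀ θ' j) w ^ 2 := by
    intro s hs hs'
    simp only [thetaTilde]
    rw [sum_sq_inner_gramSchmidtNormed _ hs, sum_sq_inner_gramSchmidtNormed _ hs,
      h.span_update_eq h' hlam θ₀ hs']
  rw [hsplit, hsplit, h1, h1]
  · intro i j hij hi
    simp only [Finset.coe_filter, Finset.mem_univ, true_and, Set.mem_ofPred_eq] at hi ⊢
    exact hi.trans_le (h.antitone hij)
  · intro i j hij
    simp [hij]
  · intro i j hij hi
    simp only [Finset.coe_filter, Finset.mem_univ, true_and, Set.mem_ofPred_eq] at hi ⊢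
    exact hi.trans (h.antitone hij)
  · intro i j hij
    simp [hij]

end IsEigensystem

theorem qHPV_unique {n p : ℕ} [NeZero p] {x : Fin n → EuclideanSpace ℝ (Fin p)}
    {lam lam' : Fin p → ℝ} {θ θ' : Fin p → EuclideanSpace ℝ (Fin p)}
    (h : IsEigensystem (sampleCov x) lam θ) (h' : IsEigensystem (sampleCov x) lam' θ')
    (hlam : lam 0 = 0 ∨ ∀ j, j ≠ 0 → lam j ≠ lam 0) (θ₀ : EuclideanSpace ℝ (Fin p)) :
    qHPV θ₀ x lam θ = qHPV θ₀ x lam' θ' := by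
  obtain rfl := h.lam_unique h'
  rcases hlam with h0 | hlam
  · simp [qHPV, h0]
  rw [qHPV_eq, qHPV_eq]
  congr 1
  set w := (sampleCov x).toEuclideanLin θ₀
  have key : ∀ θ : Fin p → EuclideanSpace ℝ (Fin p),
      ∑ j ∈ Finset.univ.erase (0 : Fin p), (lam j)⁻¹ * inner ℝ (thetaTilde θ₀ θ j) w ^ 2
        = ∑ c ∈ (Finset.univ.image lam).erase (lam 0),
          c⁻¹ * ∑ j with lam j = c, inner ℝ (thetaTilde θ₀ θ j) w ^ 2 := by
    intro θ
    rw [← Finset.sum_fiberwise_of_maps_to (g := lam) (t := (Finset.univ.image lam).erase (lam 0))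
      (fun j hj => Finset.mem_erase.2 ⟨hlam j (Finset.ne_of_mem_erase hj), by simp⟩)]
    refine Finset.sum_congr rfl fun c hc => ?_
    rw [Finset.mul_sum]
    refine Finset.sum_congr ?_ ?_
    · ext j
      simp only [Finset.mem_filter, Finset.mem_erase, Finset.mem_univ, and_true, true_and,
        and_iff_right_iff_imp]
      rintro hj rfl
      exact (Finset.ne_of_mem_erase hc) hj.symm
    · intro j hj
      rw [(Finset.mem_filter.1 hj).2]
  rw [key, key]
  exact Finset.sum_congr rfl fun c _ => by
    rw [h.sum_sq_inner_thetaTilde_unique h' hlam]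

/-! ### Perturbation of the spectrum of a spiked matrix -/

theorem toEuclideanLin_vecMulVec {ι : Type*} [Fintype ι] [DecidableEq ι]
    (a b c : EuclideanSpace ℝ ι) :
    (Matrix.vecMulVec a.ofLp b.ofLp).toEuclideanLin c = inner ℝ b c • a := by
  apply WithLp.ofLp_injective 2
  ext i
  rw [← dotProduct_ofLp]
  simp [Matrix.mulVec, dotProduct, Matrix.vecMulVec_apply, Finset.sum_mul]
  exact Finset.sum_congr rfl fun _ _ => by ring

theorem toEuclideanLin_spikedCov {p : ℕ} (θ c : EuclideanSpace ℝ (Fin p)) (r v : ℝ) :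
    (spikedCov θ r v).toEuclideanLin c = c + (r * v * inner ℝ θ c) • θ := by
  rw [spikedCov, map_add, map_smul, LinearMap.add_apply, LinearMap.smul_apply,
    toEuclideanLin_vecMulVec, smul_smul]
  congr 1
  apply WithLp.ofLp_injective 2
  simp

namespace IsEigensystem

variable {p : ℕ} [NeZero p] {S : Matrix (Fin p) (Fin p) ℝ} {lam : Fin p → ℝ}
  {θ : Fin p → EuclideanSpace ℝ (Fin p)}

section Perturbation

variable {θ₀ : EuclideanSpace ℝ (Fin p)} {σ δ : ℝ}

theorem abs_lam_zero_sub_le (h : IsEigensystem S lam θ) (hθ₀ : ‖θ₀‖ = 1) (hσ : 1 ≤ σ)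
    (hS : ∀ c, |inner ℝ c (S.toEuclideanLin c) - (‖c‖ ^ 2 + (σ - 1) * inner ℝ θ₀ c ^ 2)|
      ≤ δ * ‖c‖ ^ 2) : |lam 0 - σ| ≤ δ := by
  have h1 := abs_le.1 (hS θ₀)
  have h2 := h.inner_self_apply_le θ₀
  have h3 := abs_le.1 (hS (θ 0))
  rw [h.inner_apply_self, h.norm_eq_one] at h3
  rw [real_inner_self_eq_norm_sq, hθ₀] at h1
  rw [hθ₀] at h2
  have h4 : inner ℝ θ₀ (θ 0) ^ 2 ≤ 1 := by
    have := abs_real_inner_le_norm θ₀ (θ 0)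
    rw [hθ₀, h.norm_eq_one, mul_one] at this
    rwa [sq_le_one_iff_abs_le_one]
  rw [abs_le]
  constructor
  · linarith [h1.1]
  · nlinarith [h3.2]

theorem abs_lam_sub_one_le (h : IsEigensystem S lam θ) (hσ : 1 ≤ σ)
    (hS : ∀ c, |inner ℝ c (S.toEuclideanLin c) - (‖c‖ ^ 2 + (σ - 1) * inner ℝ θ₀ c ^ 2)|
      ≤ δ * ‖c‖ ^ 2) {j : Fin p} (hj : j ≠ 0) : |lam j - 1| ≤ δ := by
  have h3 := abs_le.1 (hS (θ j))
  rw [h.inner_apply_self, h.norm_eq_one] at h3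
  rw [abs_le]
  constructor
  · nlinarith [h3.1, sq_nonneg (inner ℝ θ₀ (θ j))]
  obtain ⟨a, b, hab, h0⟩ : ∃ a b : ℝ, 0 < a ^ 2 + b ^ 2 ∧
      a * inner ℝ θ₀ (θ 0) + b * inner ℝ θ₀ (θ j) = 0 := by
    by_cases hz : inner ℝ θ₀ (θ 0) = 0
    · exact ⟨1, 0, by norm_num, by simp [hz]⟩
    · exact ⟨inner ℝ θ₀ (θ j), -inner ℝ θ₀ (θ 0), by
        have := pow_pos (abs_pos.2 hz) 2
        rw [sq_abs] at this
        nlinarith [sq_nonneg (inner ℝ θ₀ (θ j))], by ring⟩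
  set c := a • θ 0 + b • θ j with hc
  have ho : inner ℝ (θ 0) (θ j) = 0 := h.orthonormal.2 hj.symm
  have ho' : inner ℝ (θ j) (θ 0) = 0 := h.orthonormal.2 hj
  have hii : ∀ i, inner ℝ (θ i) (θ i) = 1 := fun i => by
    rw [real_inner_self_eq_norm_sq, h.norm_eq_one]; norm_num
  have hcn : ‖c‖ ^ 2 = a ^ 2 + b ^ 2 := by
    rw [← real_inner_self_eq_norm_sq, hc]
    simp only [inner_add_left, inner_add_right, inner_smul_left, inner_smul_right, ho, ho', hii]
    simp; ring
  have hcS : inner ℝ c (S.toEuclideanLin c) = lam 0 * a ^ 2 + lam j * b ^ 2 := by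
    rw [hc, map_add, map_smul, map_smul, h.toEuclideanLin_apply, h.toEuclideanLin_apply]
    simp only [inner_add_left, inner_add_right, inner_smul_left, inner_smul_right, ho, ho', hii]
    simp; ring
  have hc0 : inner ℝ θ₀ c = 0 := by
    rw [hc, inner_add_right, inner_smul_right, inner_smul_right, h0]
  have h5 := (abs_le.1 (hS c)).2
  rw [hc0, hcS, hcn] at h5
  have h6 := h.antitone (Fin.zero_le j)
  nlinarith [mul_le_mul_of_nonneg_right h6 (sq_nonneg a)]

end Perturbation

end IsEigensystem

/-! ### Affine equivariance of the sample covariance matrix -/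

section SampleCov

variable {n p : ℕ}

theorem toEuclideanLin_sampleCov (x : Fin n → EuclideanSpace ℝ (Fin p))
    (c : EuclideanSpace ℝ (Fin p)) :
    (sampleCov x).toEuclideanLin c
      = (n : ℝ)⁻¹ • ∑ i, inner ℝ (x i - sampleMean x) c • (x i - sampleMean x) := by
  rw [sampleCov, map_smul, map_sum, LinearMap.smul_apply, LinearMap.sum_apply]
  simp_rw [toEuclideanLin_vecMulVec]

theorem inner_sampleCov (x : Fin n → EuclideanSpace ℝ (Fin p)) (a c : EuclideanSpace ℝ (Fin p)) :
    inner ℝ a ((sampleCov x).toEuclideanLin c)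
      = (n : ℝ)⁻¹ * ∑ i, inner ℝ a (x i - sampleMean x) * inner ℝ c (x i - sampleMean x) := by
  rw [toEuclideanLin_sampleCov, inner_smul_right, inner_sum]
  congr 1
  refine Finset.sum_congr rfl fun i _ => ?_
  rw [inner_smul_right, real_inner_comm, mul_comm]

theorem sampleMean_map (A : Matrix (Fin p) (Fin p) ℝ) (y : Fin n → EuclideanSpace ℝ (Fin p)) :
    sampleMean (fun i => A.toEuclideanLin (y i)) = A.toEuclideanLin (sampleMean y) := by
  rw [sampleMean, sampleMean, map_smul, map_sum]

theorem sampleCov_map (A : Matrix (Fin p) (Fin p) ℝ) (y : Fin n → EuclideanSpace ℝ (Fin p)) :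
    sampleCov (fun i => A.toEuclideanLin (y i)) = A * sampleCov y * Aᵀ := by
  rw [sampleCov, sampleCov, Matrix.mul_smul, Matrix.smul_mul, Matrix.mul_sum, Matrix.sum_mul]
  congr 1
  refine Finset.sum_congr rfl fun i _ => ?_
  rw [sampleMean_map, ← map_sub, Matrix.mul_vecMulVec, Matrix.vecMulVec_mul,
    Matrix.vecMul_transpose]
  simp [Matrix.mulVec_sub]

theorem sampleSqDist_map {A : Matrix (Fin p) (Fin p) ℝ} (hA : IsUnit A.det)
    (y : Fin n → EuclideanSpace ℝ (Fin p)) (i : Fin n) :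
    sampleSqDist (fun i => A.toEuclideanLin (y i)) i = sampleSqDist y i := by
  have hA' : IsUnit Aᵀ.det := by rwa [Matrix.det_transpose]
  rw [sampleSqDist, sampleSqDist, sampleCov_map, sampleMean_map, ← map_sub,
    Matrix.mul_inv_rev, Matrix.mul_inv_rev]
  set z := y i - sampleMean y
  have h1 : (A.toEuclideanLin z).ofLp = A *ᵥ z.ofLp := by simp
  have h2 : (Aᵀ⁻¹ * ((sampleCov y)⁻¹ * A⁻¹)) *ᵥ (A *ᵥ z.ofLp)
      = Aᵀ⁻¹ *ᵥ ((sampleCov y)⁻¹ *ᵥ z.ofLp) := by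
    rw [Matrix.mulVec_mulVec, Matrix.mulVec_mulVec, Matrix.mul_assoc, Matrix.mul_assoc,
      Matrix.nonsing_inv_mul _ hA, Matrix.mul_one]
  rw [h1, h2, Matrix.dotProduct_mulVec, ← Matrix.vecMul_transpose, Matrix.vecMul_vecMul,
    Matrix.mul_nonsing_inv _ hA', Matrix.vecMul_one]

theorem kurtosisHat_map {A : Matrix (Fin p) (Fin p) ℝ} (hA : IsUnit A.det)
    (y : Fin n → EuclideanSpace ℝ (Fin p)) :
    kurtosisHat (fun i => A.toEuclideanLin (y i)) = kurtosisHat y := by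
  simp only [kurtosisHat, sampleSqDist_map hA]

end SampleCov

theorem spikedCov_transpose {p : ℕ} (θ : EuclideanSpace ℝ (Fin p)) (r v : ℝ) :
    (spikedCov θ r v)ᵀ = spikedCov θ r v := by
  simp [spikedCov]

theorem spikedCov_mul_self {p : ℕ} {θ : EuclideanSpace ℝ (Fin p)} (hθ : ‖θ‖ = 1) {r v s : ℝ}
    (hs : s ^ 2 = 1 + r * v) :
    spikedCov θ 1 (s - 1) * spikedCov θ 1 (s - 1) = spikedCov θ r v := by
  have h1 : Matrix.vecMulVec θ.ofLp θ.ofLp * Matrix.vecMulVec θ.ofLp θ.ofLp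
      = Matrix.vecMulVec θ.ofLp θ.ofLp := by
    rw [Matrix.vecMulVec_mul_vecMulVec, dotProduct_ofLp, real_inner_self_eq_norm_sq, hθ]
    simp
  simp only [spikedCov, add_mul, mul_add, one_mul, mul_one, smul_mul_assoc, mul_smul_comm, h1]
  have : r * v = s ^ 2 - 1 := by linarith
  rw [this]
  module

theorem det_spikedCov {p : ℕ} {θ : EuclideanSpace ℝ (Fin p)} (hθ : ‖θ‖ = 1) (r v : ℝ) :
    (spikedCov θ r v).det = 1 + r * v := by
  rw [spikedCov, ← Matrix.smul_vecMulVec, Matrix.vecMulVec_eq Unit,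
    Matrix.det_one_add_replicateCol_mul_replicateRow, dotProduct_smul, dotProduct_ofLp,
    real_inner_self_eq_norm_sq, hθ]
  simp

/-! ### Convergence along a fixed sequence of observations -/

section Deterministic

variable {p : ℕ}

theorem abs_inner_toEuclideanLin_le (B : Matrix (Fin p) (Fin p) ℝ)
    (c : EuclideanSpace ℝ (Fin p)) :
    |inner ℝ c (B.toEuclideanLin c)| ≤ (∑ a, ∑ b, |B a b|) * ‖c‖ ^ 2 := by
  have hc : ∀ a, |c.ofLp a| ≤ ‖c‖ := fun a => by
    simpa using PiLp.norm_apply_le c a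
  rw [← dotProduct_mulVec_ofLp, dotProduct]
  simp only [Matrix.mulVec, dotProduct]
  refine (Finset.abs_sum_le_sum_abs _ _).trans ?_
  rw [Finset.sum_mul]
  refine Finset.sum_le_sum fun a _ => ?_
  rw [abs_mul, Finset.sum_mul]
  calc |c.ofLp a| * |∑ b, B a b * c.ofLp b| ≤ ‖c‖ * ∑ b, |B a b| * ‖c‖ := by
        refine mul_le_mul (hc a) ((Finset.abs_sum_le_sum_abs _ _).trans
          (Finset.sum_le_sum fun b _ => ?_)) (abs_nonneg _) (norm_nonneg _)
        rw [abs_mul]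
        exact mul_le_mul_of_nonneg_left (hc b) (abs_nonneg _)
    _ = ∑ b, |B a b| * ‖c‖ ^ 2 := by
        rw [Finset.mul_sum]
        exact Finset.sum_congr rfl fun b _ => by ring

theorem tendsto_sum_abs_sub_one {B : ℕ → Matrix (Fin p) (Fin p) ℝ}
    (hB : Tendsto B atTop (𝓝 1)) :
    Tendsto (fun n => ∑ a, ∑ b, |(B n - 1) a b|) atTop (𝓝 0) := by
  have h : Continuous fun B : Matrix (Fin p) (Fin p) ℝ => ∑ a, ∑ b, |(B - 1) a b| := by
    fun_prop
  simpa [Function.comp_def] using h.continuousAt.tendsto.comp hB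

theorem toEuclideanLin_one_apply (c : EuclideanSpace ℝ (Fin p)) :
    (1 : Matrix (Fin p) (Fin p) ℝ).toEuclideanLin c = c := by
  apply WithLp.ofLp_injective 2
  simp

theorem abs_inner_sub_norm_sq_le (B : Matrix (Fin p) (Fin p) ℝ)
    (c : EuclideanSpace ℝ (Fin p)) :
    |inner ℝ c (B.toEuclideanLin c) - ‖c‖ ^ 2| ≤ (∑ a, ∑ b, |(B - 1) a b|) * ‖c‖ ^ 2 := by
  have := abs_inner_toEuclideanLin_le (B - 1) c
  rwa [map_sub, LinearMap.sub_apply, toEuclideanLin_one_apply, inner_sub_right,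
    real_inner_self_eq_norm_sq] at this

theorem sampleSqDist_eq {n : ℕ} (x : Fin n → EuclideanSpace ℝ (Fin p)) (i : Fin n) :
    sampleSqDist x i = inner ℝ (x i - sampleMean x)
      ((sampleCov x)⁻¹.toEuclideanLin (x i - sampleMean x)) := by
  rw [sampleSqDist, dotProduct_mulVec_ofLp]

theorem sum_norm_sq_sub_sampleMean {n : ℕ} (x : Fin n → EuclideanSpace ℝ (Fin p)) :
    (n : ℝ)⁻¹ * ∑ i, ‖x i - sampleMean x‖ ^ 2 = (sampleCov x).trace := by
  rw [sampleCov, Matrix.trace_smul, Matrix.trace_sum, smul_eq_mul]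
  congr 1
  refine Finset.sum_congr rfl fun i _ => ?_
  rw [Matrix.trace_vecMulVec, dotProduct_ofLp, real_inner_self_eq_norm_sq]

theorem abs_pow_four_sub_le {a t e : ℝ} (ha : 0 ≤ a) (ht : 0 ≤ t) (he : e ≤ 1)
    (h : |a - t| ≤ e) : |a ^ 4 - t ^ 4| ≤ e * (32 * (1 + t ^ 4)) := by
  have h1 : a ^ 4 - t ^ 4 = (a - t) * ((a + t) * (a ^ 2 + t ^ 2)) := by ring
  have hat : a ≤ t + 1 := by linarith [(abs_le.1 h).2]
  rw [h1, abs_mul]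
  refine mul_le_mul h ?_ (abs_nonneg _) ((abs_nonneg _).trans h)
  rw [abs_of_nonneg (by positivity)]
  calc (a + t) * (a ^ 2 + t ^ 2) ≤ (t + 1 + t) * ((t + 1) ^ 2 + t ^ 2) := by gcongr
    _ ≤ 32 * (1 + t ^ 4) := by
      nlinarith [sq_nonneg (t ^ 2 - t), sq_nonneg (t - 1), sq_nonneg (t ^ 2 - 1)]

theorem tendsto_mean_norm_pow_four_sub_sampleMean {y : ℕ → EuclideanSpace ℝ (Fin p)} {M : ℝ}
    (hmean : Tendsto (fun n : ℕ => sampleMean fun i : Fin n => y i) atTop (𝓝 0))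
    (hM : Tendsto (fun n : ℕ => (n : ℝ)⁻¹ * ∑ i : Fin n, ‖y i‖ ^ 4) atTop (𝓝 M)) :
    Tendsto (fun n : ℕ => (n : ℝ)⁻¹ * ∑ i : Fin n,
      ‖y i - sampleMean fun i : Fin n => y i‖ ^ 4) atTop (𝓝 M) := by
  have he : Tendsto (fun n : ℕ => ‖sampleMean fun i : Fin n => y i‖) atTop (𝓝 0) := by
    simpa using hmean.norm
  have hb : Tendsto (fun n : ℕ => ‖sampleMean fun i : Fin n => y i‖ *
      (32 * (1 + (n : ℝ)⁻¹ * ∑ i : Fin n, ‖y i‖ ^ 4))) atTop (𝓝 0) := by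
    simpa using he.mul ((hM.const_add 1).const_mul 32)
  have hd : Tendsto (fun n : ℕ => (n : ℝ)⁻¹ * ∑ i : Fin n,
      ‖y i - sampleMean fun i : Fin n => y i‖ ^ 4 - (n : ℝ)⁻¹ * ∑ i : Fin n, ‖y i‖ ^ 4)
      atTop (𝓝 0) := by
    refine squeeze_zero_norm' ?_ hb
    filter_upwards [he.eventually_le_const one_pos, eventually_gt_atTop 0] with n hn hn0
    have hn0' : (0 : ℝ) < n := by exact_mod_cast hn0
    rw [← mul_sub, ← Finset.sum_sub_distrib, Real.norm_eq_abs, abs_mul,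
      abs_of_nonneg (inv_nonneg.2 hn0'.le)]
    set m := sampleMean fun i : Fin n => y i
    calc (n : ℝ)⁻¹ * |∑ i : Fin n, (‖y i - m‖ ^ 4 - ‖y i‖ ^ 4)|
        ≤ (n : ℝ)⁻¹ * ∑ i : Fin n, ‖m‖ * (32 * (1 + ‖y i‖ ^ 4)) := by
          gcongr
          refine (Finset.abs_sum_le_sum_abs _ _).trans (Finset.sum_le_sum fun i _ => ?_)
          refine abs_pow_four_sub_le (norm_nonneg _) (norm_nonneg _) hn ?_
          simpa using abs_norm_sub_norm_le (y i - m) (y i)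
      _ = ‖m‖ * (32 * (1 + (n : ℝ)⁻¹ * ∑ i : Fin n, ‖y i‖ ^ 4)) := by
          rw [← Finset.mul_sum, ← Finset.mul_sum, Finset.sum_add_distrib]
          simp only [Finset.sum_const, Finset.card_univ, Fintype.card_fin, nsmul_eq_mul, mul_one]
          field_simp
  simpa using hd.add hM

theorem tendsto_kurtosisHat (hp : p ≠ 0) {y : ℕ → EuclideanSpace ℝ (Fin p)} {M : ℝ}
    (hmean : Tendsto (fun n : ℕ => sampleMean fun i : Fin n => y i) atTop (𝓝 0))
    (hcov : Tendsto (fun n : ℕ => sampleCov fun i : Fin n => y i) atTop (𝓝 1))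
    (hM : Tendsto (fun n : ℕ => (n : ℝ)⁻¹ * ∑ i : Fin n, ‖y i‖ ^ 4) atTop (𝓝 M)) :
    Tendsto (fun n : ℕ => kurtosisHat fun i : Fin n => y i) atTop (𝓝 (M / (p * (p + 2)) - 1)) := by
  have hinv : Tendsto (fun n : ℕ => (sampleCov fun i : Fin n => y i)⁻¹) atTop (𝓝 1) := by
    have hc : ContinuousAt Inv.inv (1 : Matrix (Fin p) (Fin p) ℝ) := by
      refine continuousAt_matrix_inv _ ?_
      simp only [Matrix.det_one, Ring.inverse_eq_inv']
      exact continuousAt_inv₀ one_ne_zero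
    simpa [Function.comp_def] using hc.tendsto.comp hcov
  have he := tendsto_sum_abs_sub_one hinv
  set e : ℕ → ℝ := fun n => ∑ a, ∑ b, |((sampleCov fun i : Fin n => y i)⁻¹ - 1) a b| with hedef
  have hM' := tendsto_mean_norm_pow_four_sub_sampleMean hmean hM
  have htr : Tendsto (fun n : ℕ => (n : ℝ)⁻¹ * ∑ i : Fin n,
      ‖y i - sampleMean fun i : Fin n => y i‖ ^ 2) atTop (𝓝 p) := by
    simp only [sum_norm_sq_sub_sampleMean (fun i : Fin _ => y i)]
    have hc : Continuous fun B : Matrix (Fin p) (Fin p) ℝ => B.trace := by fun_prop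
    simpa [Function.comp_def] using hc.continuousAt.tendsto.comp hcov
  have hdist : ∀ (n : ℕ) (i : Fin n), |sampleSqDist (fun i : Fin n => y i) i
      - ‖y i - sampleMean fun i : Fin n => y i‖ ^ 2|
        ≤ e n * ‖y i - sampleMean fun i : Fin n => y i‖ ^ 2 := by
    intro n i
    rw [sampleSqDist_eq]
    exact abs_inner_sub_norm_sq_le _ _
  have he0 : ∀ n, 0 ≤ e n := fun n =>
    Finset.sum_nonneg fun a _ => Finset.sum_nonneg fun b _ => abs_nonneg _
  have hmean2 : Tendsto (fun n : ℕ => (n : ℝ)⁻¹ * ∑ i, sampleSqDist (fun i : Fin n => y i) i)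
      atTop (𝓝 p) := by
    have hd : Tendsto (fun n : ℕ => (n : ℝ)⁻¹ * ∑ i, sampleSqDist (fun i : Fin n => y i) i
        - (n : ℝ)⁻¹ * ∑ i : Fin n, ‖y i - sampleMean fun i : Fin n => y i‖ ^ 2) atTop (𝓝 0) := by
      refine squeeze_zero_norm (a := fun n : ℕ => e n * ((n : ℝ)⁻¹ * ∑ i : Fin n,
        ‖y i - sampleMean fun i : Fin n => y i‖ ^ 2)) (fun n => ?_) (by simpa using he.mul htr)
      rw [← mul_sub, ← Finset.sum_sub_distrib, Real.norm_eq_abs, abs_mul,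
        abs_of_nonneg (by positivity : (0 : ℝ) ≤ (n : ℝ)⁻¹), mul_left_comm]
      gcongr
      rw [Finset.mul_sum]
      exact (Finset.abs_sum_le_sum_abs _ _).trans (Finset.sum_le_sum fun i _ => hdist n i)
    simpa using hd.add htr
  have hmean4 : Tendsto (fun n : ℕ => (n : ℝ)⁻¹ * ∑ i, sampleSqDist (fun i : Fin n => y i) i ^ 2)
      atTop (𝓝 M) := by
    have hd : Tendsto (fun n : ℕ => (n : ℝ)⁻¹ * ∑ i, sampleSqDist (fun i : Fin n => y i) i ^ 2
        - (n : ℝ)⁻¹ * ∑ i : Fin n, ‖y i - sampleMean fun i : Fin n => y i‖ ^ 4) atTop (𝓝 0) := by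
      refine squeeze_zero_norm (a := fun n : ℕ => (e n * (e n + 2)) * ((n : ℝ)⁻¹ * ∑ i : Fin n,
        ‖y i - sampleMean fun i : Fin n => y i‖ ^ 4)) (fun n => ?_)
        (by simpa using (he.mul (he.add_const 2)).mul hM')
      rw [← mul_sub, ← Finset.sum_sub_distrib, Real.norm_eq_abs, abs_mul,
        abs_of_nonneg (by positivity : (0 : ℝ) ≤ (n : ℝ)⁻¹), mul_left_comm]
      gcongr
      rw [Finset.mul_sum]
      refine (Finset.abs_sum_le_sum_abs _ _).trans (Finset.sum_le_sum fun i _ => ?_)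
      have h1 := hdist n i
      set d := sampleSqDist (fun i : Fin n => y i) i
      set z := ‖y i - sampleMean fun i : Fin n => y i‖
      have h2 : |d + z ^ 2| ≤ (e n + 2) * z ^ 2 := by
        have : d + z ^ 2 = (d - z ^ 2) + 2 * z ^ 2 := by ring
        rw [this]
        refine (abs_add_le _ _).trans ?_
        rw [abs_of_nonneg (by positivity : 0 ≤ 2 * z ^ 2)]
        linarith
      calc |d ^ 2 - z ^ 4| = |d - z ^ 2| * |d + z ^ 2| := by rw [← abs_mul]; ring_nf
        _ ≤ (e n * z ^ 2) * ((e n + 2) * z ^ 2) :=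
          mul_le_mul h1 h2 (abs_nonneg _) (mul_nonneg (he0 n) (sq_nonneg _))
        _ = e n * (e n + 2) * z ^ 4 := by ring
    simpa using hd.add hM'
  have hp' : (p : ℝ) ≠ 0 := by exact_mod_cast hp
  have hp2 : (p : ℝ) + 2 ≠ 0 := by positivity
  have hlim := ((hmean4.const_mul (p : ℝ)).div ((hmean2.pow 2).const_mul ((p : ℝ) + 2))
    (by positivity)).sub_const 1
  have e1 : (p : ℝ) * M / ((p + 2) * p ^ 2) - 1 = M / (p * (p + 2)) - 1 := by
    field_simp
  rw [e1] at hlim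
  exact hlim

section Spiked

variable {θ₀ : EuclideanSpace ℝ (Fin p)} {s : ℝ}

theorem inner_spikedCov_left (a c : EuclideanSpace ℝ (Fin p)) (r v : ℝ) :
    inner ℝ ((spikedCov θ₀ r v).toEuclideanLin a) c
      = inner ℝ a ((spikedCov θ₀ r v).toEuclideanLin c) := by
  simp only [toEuclideanLin_spikedCov, inner_add_left, inner_add_right, inner_smul_left,
    inner_smul_right, real_inner_comm θ₀ a]
  simp; ring

theorem inner_self_spikedCov (hθ₀ : ‖θ₀‖ = 1) (w : EuclideanSpace ℝ (Fin p)) :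
    inner ℝ θ₀ ((spikedCov θ₀ 1 (s - 1)).toEuclideanLin w) = s * inner ℝ θ₀ w := by
  rw [toEuclideanLin_spikedCov, inner_add_right, inner_smul_right, real_inner_self_eq_norm_sq, hθ₀]
  ring

theorem norm_sq_spikedCov (hθ₀ : ‖θ₀‖ = 1) (w : EuclideanSpace ℝ (Fin p)) :
    ‖(spikedCov θ₀ 1 (s - 1)).toEuclideanLin w‖ ^ 2
      = ‖w‖ ^ 2 + (s ^ 2 - 1) * inner ℝ θ₀ w ^ 2 := by
  rw [← real_inner_self_eq_norm_sq, toEuclideanLin_spikedCov]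
  simp only [inner_add_left, inner_add_right, inner_smul_left,
    inner_smul_right, real_inner_comm θ₀ w, real_inner_self_eq_norm_sq, hθ₀]
  simp; ring

theorem sampleCov_spiked_apply {n : ℕ} (y : Fin n → EuclideanSpace ℝ (Fin p))
    (c : EuclideanSpace ℝ (Fin p)) :
    (sampleCov fun i => (spikedCov θ₀ 1 (s - 1)).toEuclideanLin (y i)).toEuclideanLin c
      = (spikedCov θ₀ 1 (s - 1)).toEuclideanLin ((sampleCov y).toEuclideanLin
          ((spikedCov θ₀ 1 (s - 1)).toEuclideanLin c)) := by
  rw [sampleCov_map, spikedCov_transpose]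
  apply WithLp.ofLp_injective 2
  simp [Matrix.mulVec_mulVec, Matrix.mul_assoc]

theorem abs_inner_sampleCov_spiked_le {n : ℕ} (hθ₀ : ‖θ₀‖ = 1) (hs : 1 ≤ s)
    (y : Fin n → EuclideanSpace ℝ (Fin p)) (c : EuclideanSpace ℝ (Fin p)) :
    |inner ℝ c ((sampleCov fun i =>
          (spikedCov θ₀ 1 (s - 1)).toEuclideanLin (y i)).toEuclideanLin c)
        - (‖c‖ ^ 2 + (s ^ 2 - 1) * inner ℝ θ₀ c ^ 2)|
      ≤ (s ^ 2 * ∑ a, ∑ b, |(sampleCov y - 1) a b|) * ‖c‖ ^ 2 := by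
  rw [sampleCov_spiked_apply, ← inner_spikedCov_left, ← norm_sq_spikedCov hθ₀]
  refine (abs_inner_sub_norm_sq_le _ _).trans ?_
  rw [mul_comm (s ^ 2), mul_assoc]
  refine mul_le_mul_of_nonneg_left ?_
    (Finset.sum_nonneg fun a _ => Finset.sum_nonneg fun b _ => abs_nonneg _)
  rw [norm_sq_spikedCov hθ₀]
  have h1 : inner ℝ θ₀ c ^ 2 ≤ ‖c‖ ^ 2 := by
    have := abs_real_inner_le_norm θ₀ c
    rw [hθ₀, one_mul] at this
    exact sq_le_sq' (abs_le.1 this).1 (abs_le.1 this).2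
  have hs2 : 1 ≤ s ^ 2 := one_le_pow₀ hs
  linarith [mul_le_mul_of_nonneg_left h1 (sub_nonneg.2 hs2)]

/-- The squared norm of the component of `S θ₀` orthogonal to `θ₀`. -/
def residualSq {n : ℕ} (θ₀ : EuclideanSpace ℝ (Fin p)) (x : Fin n → EuclideanSpace ℝ (Fin p)) :
    ℝ :=
  ‖(sampleCov x).toEuclideanLin θ₀‖ ^ 2 - inner ℝ θ₀ ((sampleCov x).toEuclideanLin θ₀) ^ 2

theorem residualSq_nonneg {n : ℕ} (hθ₀ : ‖θ₀‖ = 1) (x : Fin n → EuclideanSpace ℝ (Fin p)) :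
    0 ≤ residualSq θ₀ x := by
  have := abs_real_inner_le_norm θ₀ ((sampleCov x).toEuclideanLin θ₀)
  rw [hθ₀, one_mul] at this
  exact sub_nonneg.2 (sq_le_sq' (abs_le.1 this).1 (abs_le.1 this).2)

theorem residualSq_spiked {n : ℕ} (hθ₀ : ‖θ₀‖ = 1) (y : Fin n → EuclideanSpace ℝ (Fin p)) :
    residualSq θ₀ (fun i => (spikedCov θ₀ 1 (s - 1)).toEuclideanLin (y i))
      = s ^ 2 * residualSq θ₀ y := by
  have h1 : (spikedCov θ₀ 1 (s - 1)).toEuclideanLin θ₀ = s • θ₀ := by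
    rw [toEuclideanLin_spikedCov, real_inner_self_eq_norm_sq, hθ₀]
    module
  rw [residualSq, sampleCov_spiked_apply, h1, map_smul, map_smul, norm_smul, inner_smul_right,
    inner_self_spikedCov hθ₀, mul_pow, norm_sq_spikedCov hθ₀, residualSq, Real.norm_eq_abs, sq_abs]
  ring

theorem abs_qHPV_sub_le {n : ℕ} [NeZero p] (hθ₀ : ‖θ₀‖ = 1) (hs : s ≠ 0)
    (y : Fin n → EuclideanSpace ℝ (Fin p)) {lam : Fin p → ℝ}
    {θ : Fin p → EuclideanSpace ℝ (Fin p)}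
    (h : IsEigensystem (sampleCov fun i => (spikedCov θ₀ 1 (s - 1)).toEuclideanLin (y i)) lam θ) :
    |qHPV θ₀ (fun i => (spikedCov θ₀ 1 (s - 1)).toEuclideanLin (y i)) lam θ - n * residualSq θ₀ y|
      ≤ (∑ j ∈ Finset.univ.erase (0 : Fin p), |s ^ 2 / (lam 0 * lam j) - 1|)
          * (n * residualSq θ₀ y) := by
  set x : Fin n → EuclideanSpace ℝ (Fin p) :=
    fun i => (spikedCov θ₀ 1 (s - 1)).toEuclideanLin (y i) with hx
  have hsum := h.sum_sq_inner_thetaTilde hθ₀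
  rw [← residualSq, residualSq_spiked hθ₀] at hsum
  have hs2 : (0 : ℝ) < s ^ 2 := by positivity
  have hR : n * residualSq θ₀ y = n / s ^ 2 * ∑ j ∈ Finset.univ.erase (0 : Fin p),
      inner ℝ (thetaTilde θ₀ θ j) ((sampleCov x).toEuclideanLin θ₀) ^ 2 := by
    rw [hsum]; field_simp
  set u : Fin p → ℝ :=
    fun j => inner ℝ (thetaTilde θ₀ θ j) ((sampleCov x).toEuclideanLin θ₀) ^ 2 with hu
  have hu0 : ∀ j, 0 ≤ u j := fun j => sq_nonneg _
  have hQ : qHPV θ₀ x lam θ - n * residualSq θ₀ y = ∑ j ∈ Finset.univ.erase (0 : Fin p),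
      (s ^ 2 / (lam 0 * lam j) - 1) * (n / s ^ 2 * u j) := by
    rw [qHPV_eq, hR, Finset.mul_sum, Finset.mul_sum, ← Finset.sum_sub_distrib]
    refine Finset.sum_congr rfl fun j _ => ?_
    have e : s ^ 2 / (lam 0 * lam j) * (n / s ^ 2 * u j) = n / lam 0 * ((lam j)⁻¹ * u j) := by
      rw [div_eq_mul_inv, mul_inv, div_eq_mul_inv, div_eq_mul_inv]
      field_simp
    rw [sub_mul, one_mul, e]
  rw [hQ, Finset.sum_mul]
  refine (Finset.abs_sum_le_sum_abs _ _).trans (Finset.sum_le_sum fun j hj => ?_)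
  rw [abs_mul, abs_of_nonneg (by have := hu0 j; positivity : 0 ≤ n / s ^ 2 * u j)]
  refine mul_le_mul_of_nonneg_left ?_ (abs_nonneg _)
  rw [hR]
  exact mul_le_mul_of_nonneg_left (Finset.single_le_sum (fun j _ => hu0 j) hj) (by positivity)

end Spiked

section Asymptotic

variable {θ₀ : EuclideanSpace ℝ (Fin p)} {y : ℕ → EuclideanSpace ℝ (Fin p)} {s : ℕ → ℝ} {K m : ℝ}

theorem tendsto_sum_abs_div_lam_sub_one [NeZero p] (hθ₀ : ‖θ₀‖ = 1) (hs : ∀ᶠ n in atTop, 1 ≤ s n)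
    (hK : ∀ᶠ n in atTop, s n ^ 2 ≤ K)
    (hcov : Tendsto (fun n : ℕ => sampleCov fun i : Fin n => y i) atTop (𝓝 1))
    {lam : ℕ → Fin p → ℝ} {θ : ℕ → Fin p → EuclideanSpace ℝ (Fin p)}
    (h : ∀ n, IsEigensystem (sampleCov fun i : Fin n =>
      (spikedCov θ₀ 1 (s n - 1)).toEuclideanLin (y i)) (lam n) (θ n)) :
    Tendsto (fun n => ∑ j ∈ Finset.univ.erase (0 : Fin p), |s n ^ 2 / (lam n 0 * lam n j) - 1|)
      atTop (𝓝 0) := by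
  have he := tendsto_sum_abs_sub_one hcov
  set e : ℕ → ℝ := fun n => ∑ a, ∑ b, |((sampleCov fun i : Fin n => y i) - 1) a b| with hedef
  have he0 : ∀ n, 0 ≤ e n := fun n =>
    Finset.sum_nonneg fun a _ => Finset.sum_nonneg fun b _ => abs_nonneg _
  have hKe : Tendsto (fun n => K * e n) atTop (𝓝 0) := by simpa using he.const_mul K
  have hbound : ∀ᶠ n in atTop, ∀ c, |inner ℝ c ((sampleCov fun i : Fin n =>
      (spikedCov θ₀ 1 (s n - 1)).toEuclideanLin (y i)).toEuclideanLin c)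
        - (‖c‖ ^ 2 + (s n ^ 2 - 1) * inner ℝ θ₀ c ^ 2)| ≤ K * e n * ‖c‖ ^ 2 := by
    filter_upwards [hs, hK] with n hn hnK c
    refine (abs_inner_sampleCov_spiked_le hθ₀ hn _ c).trans ?_
    have := he0 n
    gcongr
  have hj : ∀ j, j ≠ 0 → Tendsto (fun n => lam n j) atTop (𝓝 1) := by
    intro j hj
    rw [tendsto_iff_norm_sub_tendsto_zero]
    refine squeeze_zero' (.of_forall fun n => norm_nonneg _) ?_ hKe
    filter_upwards [hs, hbound] with n hn hb
    exact (h n).abs_lam_sub_one_le (one_le_pow₀ hn) hb hj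
  have h0 : Tendsto (fun n => lam n 0 / s n ^ 2) atTop (𝓝 1) := by
    rw [tendsto_iff_norm_sub_tendsto_zero]
    refine squeeze_zero' (.of_forall fun n => norm_nonneg _) ?_ hKe
    filter_upwards [hs, hbound] with n hn hb
    have hs2 : 1 ≤ s n ^ 2 := one_le_pow₀ hn
    have h1 := (h n).abs_lam_zero_sub_le hθ₀ hs2 hb
    have e1 : lam n 0 / s n ^ 2 - 1 = (lam n 0 - s n ^ 2) / s n ^ 2 := by
      rw [sub_div, div_self (by positivity)]
    rw [Real.norm_eq_abs, e1, abs_div, abs_of_nonneg (by positivity : 0 ≤ s n ^ 2)]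
    exact (div_le_self (abs_nonneg _) hs2).trans h1
  rw [show (0 : ℝ) = ∑ j ∈ Finset.univ.erase (0 : Fin p), |((1 : ℝ) * 1)⁻¹ - 1| by simp]
  refine tendsto_finsetSum _ fun j hjm => ?_
  refine Tendsto.abs (Tendsto.sub_const ?_ 1)
  refine ((h0.mul (hj j (Finset.ne_of_mem_erase hjm))).inv₀ (by simp)).congr fun n => ?_
  rw [div_mul_eq_mul_div, inv_div]

theorem tendsto_qHPVDagger_sub [NeZero p] (hθ₀ : ‖θ₀‖ = 1)
    (hs : ∀ᶠ n in atTop, 1 ≤ s n) (hK : ∀ᶠ n in atTop, s n ^ 2 ≤ K) (hm : 0 < m)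
    (hmean : Tendsto (fun n : ℕ => sampleMean fun i : Fin n => y i) atTop (𝓝 0))
    (hcov : Tendsto (fun n : ℕ => sampleCov fun i : Fin n => y i) atTop (𝓝 1))
    (hM : Tendsto (fun n : ℕ => (n : ℝ)⁻¹ * ∑ i : Fin n, ‖y i‖ ^ 4) atTop (𝓝 (p * (p + 2) * m)))
    {lam : ℕ → Fin p → ℝ} {θ : ℕ → Fin p → EuclideanSpace ℝ (Fin p)}
    (h : ∀ n, IsEigensystem (sampleCov fun i : Fin n =>
      (spikedCov θ₀ 1 (s n - 1)).toEuclideanLin (y i)) (lam n) (θ n)) :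
    Tendsto (fun n : ℕ => kurtosisHat fun i : Fin n =>
        (spikedCov θ₀ 1 (s n - 1)).toEuclideanLin (y i)) atTop (𝓝 (m - 1)) ∧
    Tendsto (fun n : ℕ => (qHPVDagger θ₀ (fun i : Fin n =>
        (spikedCov θ₀ 1 (s n - 1)).toEuclideanLin (y i)) (lam n) (θ n)
          - n * residualSq θ₀ (fun i : Fin n => y i) / m)
        / (1 + |n * residualSq θ₀ (fun i : Fin n => y i) / m|)) atTop (𝓝 0) := by
  have hp0 : p ≠ 0 := NeZero.ne p
  have hp' : (p : ℝ) ≠ 0 := by exact_mod_cast hp0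
  have hp2 : (p : ℝ) + 2 ≠ 0 := by positivity
  have hk0 := tendsto_kurtosisHat hp0 hmean hcov hM
  rw [mul_div_cancel_left₀ _ (by positivity)] at hk0
  have hk : Tendsto (fun n : ℕ => kurtosisHat fun i : Fin n =>
        (spikedCov θ₀ 1 (s n - 1)).toEuclideanLin (y i)) atTop (𝓝 (m - 1)) := by
    refine hk0.congr' ?_
    filter_upwards [hs] with n hn
    refine (kurtosisHat_map ?_ _).symm
    rw [det_spikedCov hθ₀, isUnit_iff_ne_zero]
    linarith
  refine ⟨hk, ?_⟩
  set κ : ℕ → ℝ := fun n => kurtosisHat fun i : Fin n =>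
        (spikedCov θ₀ 1 (s n - 1)).toEuclideanLin (y i) with hκ
  have hk1 : Tendsto (fun n => m / (1 + κ n)) atTop (𝓝 1) := by
    have := (hk.const_add 1).inv₀ (by simpa using hm.ne')
    simpa [hm.ne', div_eq_mul_inv] using this.const_mul m
  have hη := tendsto_sum_abs_div_lam_sub_one hθ₀ hs hK hcov h
  set η : ℕ → ℝ := fun n =>
    ∑ j ∈ Finset.univ.erase (0 : Fin p), |s n ^ 2 / (lam n 0 * lam n j) - 1| with hηdef
  have hb : Tendsto (fun n => η n * |m / (1 + κ n)| + |m / (1 + κ n) - 1|) atTop (𝓝 0) := by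
    simpa using (hη.mul hk1.abs).add (hk1.sub_const 1).abs
  refine squeeze_zero_norm' ?_ hb
  filter_upwards [hs] with n hn
  have hQ := abs_qHPV_sub_le hθ₀ (by linarith) _ (h n)
  set Q := qHPV θ₀ (fun i : Fin n =>
        (spikedCov θ₀ 1 (s n - 1)).toEuclideanLin (y i)) (lam n) (θ n) with hQdef
  have hR0 : 0 ≤ residualSq θ₀ (fun i : Fin n => y i) := residualSq_nonneg hθ₀ _
  set W := n * residualSq θ₀ (fun i : Fin n => y i) / m with hW
  have hW0 : 0 ≤ W := by positivity
  have hWm : n * residualSq θ₀ (fun i : Fin n => y i) = m * W := by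
    rw [hW]; field_simp
  rw [hWm] at hQ
  have e1 : qHPVDagger θ₀ (fun i : Fin n =>
        (spikedCov θ₀ 1 (s n - 1)).toEuclideanLin (y i)) (lam n) (θ n) - W
      = (Q - m * W) / m * (m / (1 + κ n)) + W * (m / (1 + κ n) - 1) := by
    rw [qHPVDagger]
    change Q / (1 + κ n) - W = _
    field_simp
    ring
  rw [Real.norm_eq_abs, abs_div, abs_of_nonneg (by positivity : 0 ≤ 1 + |W|),
    div_le_iff₀ (by positivity), e1]
  refine (abs_add_le _ _).trans ?_
  rw [abs_mul, abs_mul, abs_div, abs_of_pos hm, abs_of_nonneg hW0]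
  have h1 : |Q - m * W| / m ≤ η n * W := by
    rw [div_le_iff₀ hm]; linarith
  have h2 : |Q - m * W| / m * |m / (1 + κ n)| ≤ η n * W * |m / (1 + κ n)| :=
    mul_le_mul_of_nonneg_right h1 (abs_nonneg _)
  have h3 : 0 ≤ η n := Finset.sum_nonneg fun j _ => abs_nonneg _
  nlinarith [mul_nonneg h3 (abs_nonneg (m / (1 + κ n))), abs_nonneg (m / (1 + κ n) - 1)]

end Asymptotic

end Deterministic

/-! ### Measurability of statistics computed from an eigensystem -/

section Measurability

variable {n p : ℕ}

theorem continuous_sampleMean :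
    Continuous (sampleMean : (Fin n → EuclideanSpace ℝ (Fin p)) → _) := by
  unfold sampleMean
  fun_prop

theorem continuous_sampleCov :
    Continuous (sampleCov : (Fin n → EuclideanSpace ℝ (Fin p)) → _) := by
  have := continuous_sampleMean (n := n) (p := p)
  refine continuous_matrix fun a b => ?_
  simp only [sampleCov, Matrix.smul_apply, Matrix.sum_apply, Matrix.vecMulVec_apply]
  fun_prop

theorem continuous_sampleCov_apply (a b : Fin p) :
    Continuous fun x : Fin n → EuclideanSpace ℝ (Fin p) => sampleCov x a b :=
  (continuous_apply_apply a b).comp continuous_sampleCov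

theorem isClosed_isEigensystem :
    IsClosed {q : (Fin n → EuclideanSpace ℝ (Fin p)) × (Fin p → ℝ) ×
      (Fin p → EuclideanSpace ℝ (Fin p)) | IsEigensystem (sampleCov q.1) q.2.1 q.2.2} := by
  have he : {q : (Fin n → EuclideanSpace ℝ (Fin p)) × (Fin p → ℝ) ×
      (Fin p → EuclideanSpace ℝ (Fin p)) | IsEigensystem (sampleCov q.1) q.2.1 q.2.2}
      = (⋂ i, ⋂ j, {q | i ≤ j → q.2.1 j ≤ q.2.1 i}) ∩
        ((⋂ i, ⋂ j, {q | inner ℝ (q.2.2 i) (q.2.2 j) = if i = j then (1 : ℝ) else 0}) ∩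
        ⋂ j, {q | sampleCov q.1 *ᵥ (q.2.2 j).ofLp = q.2.1 j • (q.2.2 j).ofLp}) := by
    ext q
    simp only [Set.mem_inter_iff, Set.mem_iInter, Set.mem_ofPred_eq]
    constructor
    · intro h
      exact ⟨fun i j hij => h.antitone hij, orthonormal_iff_ite.1 h.orthonormal, h.mulVec_eq⟩
    · rintro ⟨h1, h2, h3⟩
      exact ⟨fun i j hij => h1 i j hij, orthonormal_iff_ite.2 h2, h3⟩
  have hS := continuous_sampleCov (n := n) (p := p)
  rw [he]
  refine IsClosed.inter ?_ (IsClosed.inter ?_ ?_)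
  · refine isClosed_iInter fun i => isClosed_iInter fun j => ?_
    by_cases hij : i ≤ j
    · simp only [hij, true_imp_iff]
      exact isClosed_le (by fun_prop) (by fun_prop)
    · simp [hij]
  · refine isClosed_iInter fun i => isClosed_iInter fun j => ?_
    exact isClosed_eq (by fun_prop) (by fun_prop)
  · refine isClosed_iInter fun j => isClosed_eq ?_ (by fun_prop)
    exact (hS.comp continuous_fst).matrix_mulVec (by fun_prop)

/-- A chosen system of eigenvalues and eigenvectors of the sample covariance matrix. -/
def chosenEigensystem (x : Fin n → EuclideanSpace ℝ (Fin p)) :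
    (Fin p → ℝ) × (Fin p → EuclideanSpace ℝ (Fin p)) :=
  ((exists_isEigensystem x).choose, (exists_isEigensystem x).choose_spec.choose)

theorem isEigensystem_chosen (x : Fin n → EuclideanSpace ℝ (Fin p)) :
    IsEigensystem (sampleCov x) (chosenEigensystem x).1 (chosenEigensystem x).2 :=
  (exists_isEigensystem x).choose_spec.choose_spec

/-- A measurable function of a sample and an eigensystem which does not depend on the choice of the
latter is a measurable function of the sample. -/
theorem measurable_chosenEigensystem {β : Type*} [MeasurableSpace β]
    {F : (Fin n → EuclideanSpace ℝ (Fin p)) × (Fin p → ℝ) × (Fin p → EuclideanSpace ℝ (Fin p)) → β}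
    (hF : Measurable F)
    (hinv : ∀ x lam θ lam' θ', IsEigensystem (sampleCov x) lam θ →
      IsEigensystem (sampleCov x) lam' θ' → F (x, lam, θ) = F (x, lam', θ')) :
    Measurable fun x => F (x, chosenEigensystem x) := by
  let s := {q : (Fin n → EuclideanSpace ℝ (Fin p)) × (Fin p → ℝ) ×
      (Fin p → EuclideanSpace ℝ (Fin p)) | IsEigensystem (sampleCov q.1) q.2.1 q.2.2}
  have hs : MeasurableSet s := isClosed_isEigensystem.measurableSet
  have hE : StandardBorelSpace (Fin n → EuclideanSpace ℝ (Fin p)) :=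
    standardBorel_of_polish
  have hE' : StandardBorelSpace (Fin p → EuclideanSpace ℝ (Fin p)) :=
    standardBorel_of_polish
  have : StandardBorelSpace s := hs.standardBorel
  let π : s → (Fin n → EuclideanSpace ℝ (Fin p)) := fun q => q.1.1
  have hπ : Measurable π := measurable_fst.comp measurable_subtype_coe
  have hsurj : Function.Surjective π := fun x =>
    ⟨⟨(x, chosenEigensystem x), isEigensystem_chosen x⟩, rfl⟩
  refine (hπ.measurable_comp_iff_of_surjective hsurj).1 ?_
  have : (fun x => F (x, chosenEigensystem x)) ∘ π = fun q : s => F q.1 := by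
    funext q
    exact hinv _ _ _ _ _ (isEigensystem_chosen _) q.2
  rw [this]
  exact hF.comp measurable_subtype_coe

theorem measurable_chosen_lam (j : Fin p) :
    Measurable fun x : Fin n → EuclideanSpace ℝ (Fin p) => (chosenEigensystem x).1 j :=
  measurable_chosenEigensystem (F := fun q => q.2.1 j) (by fun_prop)
    fun _ _ _ _ _ h h' => by rw [h.lam_unique h']

theorem measurable_gramSchmidt (i : Fin p) :
    Measurable fun f : Fin p → EuclideanSpace ℝ (Fin p) =>
      InnerProductSpace.gramSchmidt ℝ f i := by
  induction i using WellFoundedLT.induction with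
  | ind i ih =>
    have : (fun f : Fin p → EuclideanSpace ℝ (Fin p) => InnerProductSpace.gramSchmidt ℝ f i)
        = fun f => f i - ∑ j ∈ Finset.Iio i, (inner ℝ (InnerProductSpace.gramSchmidt ℝ f j) (f i)
          / ‖InnerProductSpace.gramSchmidt ℝ f j‖ ^ 2) • InnerProductSpace.gramSchmidt ℝ f j := by
      funext f
      exact eq_sub_of_add_eq (InnerProductSpace.gramSchmidt_def'' ℝ f i).symm
    rw [this]
    refine (measurable_pi_apply i).sub (Finset.measurable_fun_sum _ fun j hj => ?_)
    have := ih j (Finset.mem_Iio.1 hj)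
    exact ((this.inner (measurable_pi_apply i)).div (this.norm.pow_const 2)).smul this

theorem measurable_thetaTilde [NeZero p] (θ₀ : EuclideanSpace ℝ (Fin p)) (j : Fin p) :
    Measurable fun θ => thetaTilde θ₀ θ j := by
  have h : Measurable fun f : Fin p → EuclideanSpace ℝ (Fin p) =>
      InnerProductSpace.gramSchmidtNormed ℝ f j := by
    have := measurable_gramSchmidt j
    exact (this.norm.inv).smul this
  refine h.comp (measurable_pi_lambda _ fun i => ?_)
  by_cases hi : i = 0
  · subst hi; simp
  · simpa [hi] using measurable_pi_apply i

theorem measurable_kurtosisHat :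
    Measurable (kurtosisHat : (Fin n → EuclideanSpace ℝ (Fin p)) → ℝ) := by
  have hS := continuous_sampleCov (n := n) (p := p)
  have hM := (continuous_sampleMean (n := n) (p := p)).measurable
  have hinv : ∀ a b, Measurable fun x : Fin n → EuclideanSpace ℝ (Fin p) =>
      (sampleCov x)⁻¹ a b := by
    intro a b
    simp only [Matrix.inv_def, Ring.inverse_eq_inv', Matrix.smul_apply, smul_eq_mul]
    exact hS.matrix_det.measurable.inv.mul
      (((continuous_apply_apply a b).comp hS.matrix_adjugate).measurable)
  have hd : ∀ i, Measurable fun x : Fin n → EuclideanSpace ℝ (Fin p) => sampleSqDist x i := by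
    intro i
    simp only [sampleSqDist, dotProduct, Matrix.mulVec]
    have hz : ∀ a, Measurable fun x : Fin n → EuclideanSpace ℝ (Fin p) =>
        (x i - sampleMean x).ofLp a := fun a =>
      (EuclideanSpace.proj (𝕜 := ℝ) a).measurable.comp ((measurable_pi_apply i).sub hM)
    exact Finset.measurable_fun_sum _ fun a _ =>
      (hz a).mul (Finset.measurable_fun_sum _ fun b _ => (hinv a b).mul (hz b))
  unfold kurtosisHat
  have h2 : Measurable fun x : Fin n → EuclideanSpace ℝ (Fin p) => ∑ i, sampleSqDist x i :=
    Finset.measurable_fun_sum _ fun i _ => hd i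
  have h4 : Measurable fun x : Fin n → EuclideanSpace ℝ (Fin p) => ∑ i, sampleSqDist x i ^ 2 :=
    Finset.measurable_fun_sum _ fun i _ => (hd i).pow_const 2
  exact (((h4.const_mul _).const_mul _).div (((h2.const_mul _).pow_const 2).const_mul _)).sub_const
    _

theorem measurable_qHPV [NeZero p] (θ₀ : EuclideanSpace ℝ (Fin p)) :
    Measurable fun q : (Fin n → EuclideanSpace ℝ (Fin p)) × (Fin p → ℝ) ×
      (Fin p → EuclideanSpace ℝ (Fin p)) => qHPV θ₀ q.1 q.2.1 q.2.2 := by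
  have hS : ∀ a b, Measurable fun q : (Fin n → EuclideanSpace ℝ (Fin p)) × (Fin p → ℝ) ×
      (Fin p → EuclideanSpace ℝ (Fin p)) => sampleCov q.1 a b := fun a b =>
    (continuous_sampleCov_apply a b).measurable.comp measurable_fst
  have hθ : ∀ j, Measurable fun q : (Fin n → EuclideanSpace ℝ (Fin p)) × (Fin p → ℝ) ×
      (Fin p → EuclideanSpace ℝ (Fin p)) => thetaTilde θ₀ q.2.2 j := fun j =>
    (measurable_thetaTilde θ₀ j).comp (measurable_snd.comp measurable_snd)
  simp only [qHPV, dotProduct, Matrix.mulVec]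
  fun_prop

/-- The statistic `Q_HPV` as a measurable function of the sample: the value `0` replaces it where
the largest eigenvalue is not simple. -/
def qHPVSample [NeZero p] (θ₀ : EuclideanSpace ℝ (Fin p)) (x : Fin n → EuclideanSpace ℝ (Fin p)) :
    ℝ :=
  open Classical in
  if (chosenEigensystem x).1 0 = 0 ∨
      ∀ j, j ≠ 0 → (chosenEigensystem x).1 j ≠ (chosenEigensystem x).1 0 then
    qHPV θ₀ x (chosenEigensystem x).1 (chosenEigensystem x).2
  else 0

theorem measurable_qHPVSample [NeZero p] (θ₀ : EuclideanSpace ℝ (Fin p)) :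
    Measurable (qHPVSample θ₀ : (Fin n → EuclideanSpace ℝ (Fin p)) → ℝ) := by
  classical
  refine measurable_chosenEigensystem (F := fun q => if q.2.1 0 = 0 ∨
      ∀ j, j ≠ 0 → q.2.1 j ≠ q.2.1 0 then qHPV θ₀ q.1 q.2.1 q.2.2 else 0)
      (Measurable.ite ?_ (measurable_qHPV θ₀) measurable_const) ?_
  · have e : {q : (Fin n → EuclideanSpace ℝ (Fin p)) × (Fin p → ℝ) ×
        (Fin p → EuclideanSpace ℝ (Fin p)) | q.2.1 0 = 0 ∨ ∀ j, j ≠ 0 → q.2.1 j ≠ q.2.1 0}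
        = {q | q.2.1 0 = 0} ∪ ⋂ j, ⋂ (_ : j ≠ 0), {q | q.2.1 j = q.2.1 0}ᶜ := by
      ext q; simp
    rw [e]
    refine MeasurableSet.union (measurableSet_eq_fun (by fun_prop) (by fun_prop)) ?_
    exact MeasurableSet.iInter fun j => MeasurableSet.iInter fun _ =>
      (measurableSet_eq_fun (by fun_prop) (by fun_prop)).compl
  · intro x lam θ lam' θ' h h'
    obtain rfl := h.lam_unique h'
    by_cases hl : lam 0 = 0 ∨ ∀ j, j ≠ 0 → lam j ≠ lam 0
    · simp only [if_pos hl]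
      exact qHPV_unique h h' hl θ₀
    · simp only [if_neg hl]

theorem qHPVSample_eq [NeZero p] {θ₀ : EuclideanSpace ℝ (Fin p)}
    {x : Fin n → EuclideanSpace ℝ (Fin p)} {lam : Fin p → ℝ}
    {θ : Fin p → EuclideanSpace ℝ (Fin p)} (h : IsEigensystem (sampleCov x) lam θ)
    (hx : (chosenEigensystem x).1 0 = 0 ∨
      ∀ j, j ≠ 0 → (chosenEigensystem x).1 j ≠ (chosenEigensystem x).1 0) :
    qHPVSample θ₀ x = qHPV θ₀ x lam θ := by
  rw [qHPVSample, if_pos hx]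
  exact qHPV_unique (isEigensystem_chosen x) h hx θ₀

end Measurability

/-! ### The largest eigenvalue is almost surely simple -/

section Simple

variable {p : ℕ}

theorem inner_sampleMean {n : ℕ} (a : EuclideanSpace ℝ (Fin p))
    (x : Fin n → EuclideanSpace ℝ (Fin p)) :
    inner ℝ a (sampleMean x) = (n : ℝ)⁻¹ * ∑ i, inner ℝ a (x i) := by
  rw [sampleMean, inner_smul_right, inner_sum]

theorem inner_sampleCov_eq_sub {n : ℕ} (x : Fin n → EuclideanSpace ℝ (Fin p))
    (a c : EuclideanSpace ℝ (Fin p)) :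
    inner ℝ a ((sampleCov x).toEuclideanLin c)
      = (n : ℝ)⁻¹ * ∑ i, inner ℝ a (x i) * inner ℝ c (x i)
        - inner ℝ a (sampleMean x) * inner ℝ c (sampleMean x) := by
  rcases Nat.eq_zero_or_pos n with rfl | hn
  · simp [inner_sampleCov, sampleMean]
  have hn' : (n : ℝ) ≠ 0 := by positivity
  have ha := inner_sampleMean a x
  have hc := inner_sampleMean c x
  rw [inner_sampleCov]
  simp only [inner_sub_right, sub_mul, mul_sub, Finset.sum_sub_distrib, ← Finset.sum_mul,
    ← Finset.mul_sum, Finset.sum_const, Finset.card_univ, Fintype.card_fin, nsmul_eq_mul]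
  have ha' : ∑ i, inner ℝ a (x i) = n * inner ℝ a (sampleMean x) := by rw [ha]; field_simp
  have hc' : ∑ i, inner ℝ c (x i) = n * inner ℝ c (sampleMean x) := by rw [hc]; field_simp
  rw [ha', hc']
  field_simp
  ring

theorem inner_sampleCov_cons {k : ℕ} (hk : k ≠ 0) (x₀ : EuclideanSpace ℝ (Fin p))
    (x : Fin k → EuclideanSpace ℝ (Fin p)) (c : EuclideanSpace ℝ (Fin p)) :
    (k + 1) * inner ℝ c ((sampleCov (Fin.cons x₀ x : Fin (k + 1) → _)).toEuclideanLin c)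
      = k * inner ℝ c ((sampleCov x).toEuclideanLin c)
        + k / (k + 1) * inner ℝ c (x₀ - sampleMean x) ^ 2 := by
  have hk' : (k : ℝ) ≠ 0 := by exact_mod_cast hk
  have hk1 : (k : ℝ) + 1 ≠ 0 := by positivity
  rw [inner_sampleCov_eq_sub, inner_sampleCov_eq_sub, inner_sub_right, inner_sampleMean,
    inner_sampleMean]
  simp only [Fin.sum_univ_succ, Fin.cons_zero, Fin.cons_succ, Nat.cast_add, Nat.cast_one]
  field_simp
  ring

theorem inner_eq_zero_of_lam_eq [NeZero p] {k : ℕ} (hk : k ≠ 0) {x₀ : EuclideanSpace ℝ (Fin p)}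
    {x : Fin k → EuclideanSpace ℝ (Fin p)} {lam lam' : Fin p → ℝ}
    {θ θ' : Fin p → EuclideanSpace ℝ (Fin p)} (h' : IsEigensystem (sampleCov x) lam' θ')
    (h : IsEigensystem (sampleCov (Fin.cons x₀ x : Fin (k + 1) → _)) lam θ)
    {j : Fin p} (hj : j ≠ 0) (hlam : lam j = lam 0) :
    inner ℝ (θ' 0) (x₀ - sampleMean x) = 0 := by
  by_contra hne
  have hk' : (0 : ℝ) < k := by exact_mod_cast Nat.pos_of_ne_zero hk
  set u := x₀ - sampleMean x with hu
  obtain ⟨a, b, hab, h0⟩ : ∃ a b : ℝ, 0 < a ^ 2 + b ^ 2 ∧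
      a * inner ℝ (θ 0) u + b * inner ℝ (θ j) u = 0 := by
    by_cases hz : inner ℝ (θ 0) u = 0
    · exact ⟨1, 0, by norm_num, by simp [hz]⟩
    · refine ⟨inner ℝ (θ j) u, -inner ℝ (θ 0) u, ?_, by ring⟩
      have := pow_pos (abs_pos.2 hz) 2
      rw [sq_abs] at this
      nlinarith [sq_nonneg (inner ℝ (θ j) u)]
  set c := a • θ 0 + b • θ j with hc
  have hcn : ‖c‖ ^ 2 = a ^ 2 + b ^ 2 := by
    rw [← real_inner_self_eq_norm_sq, hc]
    have ho : inner ℝ (θ 0) (θ j) = 0 := h.orthonormal.2 hj.symm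
    have ho' : inner ℝ (θ j) (θ 0) = 0 := h.orthonormal.2 hj
    have hii : ∀ i, inner ℝ (θ i) (θ i) = 1 := fun i => by
      rw [real_inner_self_eq_norm_sq, h.norm_eq_one]; norm_num
    simp only [inner_add_left, inner_add_right, inner_smul_left, inner_smul_right, ho, ho', hii]
    simp; ring
  have hcS : inner ℝ c ((sampleCov (Fin.cons x₀ x : Fin (k + 1) → _)).toEuclideanLin c)
      = lam 0 * ‖c‖ ^ 2 := by
    have : (sampleCov (Fin.cons x₀ x : Fin (k + 1) → _)).toEuclideanLin c = lam 0 • c := by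
      rw [hc, map_add, map_smul, map_smul, h.toEuclideanLin_apply, h.toEuclideanLin_apply, hlam]
      module
    rw [this, inner_smul_right, real_inner_self_eq_norm_sq]
  have hcu : inner ℝ c u = 0 := by
    rw [hc, inner_add_left, inner_smul_left, inner_smul_left]
    simpa using h0
  have h1 := inner_sampleCov_cons hk x₀ x c
  rw [hcS, hcu, hcn] at h1
  have h2 := h'.inner_self_apply_le c
  rw [hcn] at h2
  have h3 := inner_sampleCov_cons hk x₀ x (θ' 0)
  rw [h'.inner_apply_self] at h3
  have h4 := h.inner_self_apply_le (θ' 0)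
  rw [h'.norm_eq_one] at h4
  have h5 : 0 < k / ((k : ℝ) + 1) * inner ℝ (θ' 0) u ^ 2 := by
    have := pow_pos (abs_pos.2 hne) 2
    rw [sq_abs] at this
    positivity
  have h6 : ((k : ℝ) + 1) * lam 0 ≤ k * lam' 0 := by
    have : (((k : ℝ) + 1) * lam 0) * (a ^ 2 + b ^ 2) ≤ (k * lam' 0) * (a ^ 2 + b ^ 2) := by
      nlinarith
    exact le_of_mul_le_mul_right this hab
  nlinarith

theorem volume_setOf_inner_eq {e : EuclideanSpace ℝ (Fin p)} (he : e ≠ 0) (t : ℝ) :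
    volume {x : EuclideanSpace ℝ (Fin p) | inner ℝ e x = t} = 0 := by
  rcases Set.eq_empty_or_nonempty {x : EuclideanSpace ℝ (Fin p) | inner ℝ e x = t} with h | ⟨x, hx⟩
  · simp [h]
  have hs : {x : EuclideanSpace ℝ (Fin p) | inner ℝ e x = t}
      = (AffineSubspace.mk' x (ℝ ∙ e)ᗮ : Set (EuclideanSpace ℝ (Fin p))) := by
    ext z
    have hx' : inner ℝ e x = t := hx
    rw [SetLike.mem_coe, AffineSubspace.mem_mk', Submodule.mem_orthogonal_singleton_iff_inner_right,
      vsub_eq_sub, inner_sub_right, hx', sub_eq_zero]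
    rfl
  rw [hs]
  refine Measure.addHaar_affineSubspace _ _ fun htop => he ?_
  have hmem : x + e ∈ AffineSubspace.mk' x (ℝ ∙ e)ᗮ := by
    rw [htop]; exact AffineSubspace.mem_top _ _ _
  rw [AffineSubspace.mem_mk', Submodule.mem_orthogonal_singleton_iff_inner_right] at hmem
  simpa using hmem

theorem ae_largest_eigenvalue_simple [NeZero p] {ν : Measure (EuclideanSpace ℝ (Fin p))}
    [IsProbabilityMeasure ν] (hν : ν ≪ volume) (n : ℕ) :
    ∀ᵐ x ∂(Measure.pi fun _ : Fin n => ν), (chosenEigensystem x).1 0 = 0 ∨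
      ∀ j, j ≠ 0 → (chosenEigensystem x).1 j ≠ (chosenEigensystem x).1 0 := by
  rcases Nat.lt_or_ge n 2 with hn | hn
  · refine .of_forall fun x => Or.inl ?_
    have hS : sampleCov x = 0 := by
      interval_cases n
      · simp [sampleCov]
      · simp [sampleCov, sampleMean]
    have h := isEigensystem_chosen x
    rw [← h.inner_apply_self 0, hS]
    simp
  obtain ⟨k, rfl⟩ : ∃ k, n = k + 1 := ⟨n - 1, by omega⟩
  have hk : k ≠ 0 := by omega
  rw [ae_iff]
  set N : Set (Fin (k + 1) → EuclideanSpace ℝ (Fin p)) := {x | ¬((chosenEigensystem x).1 0 = 0 ∨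
      ∀ j, j ≠ 0 → (chosenEigensystem x).1 j ≠ (chosenEigensystem x).1 0)} with hN
  have hNm : MeasurableSet N := by
    have e : N = ({x | (chosenEigensystem x).1 0 = 0} ∪
        ⋂ j, ⋂ (_ : j ≠ 0), {x | (chosenEigensystem x).1 j = (chosenEigensystem x).1 0}ᶜ)ᶜ := by
      ext x; simp [hN]
    rw [e]
    refine (MeasurableSet.union (measurableSet_eq_fun (measurable_chosen_lam 0)
      measurable_const) ?_).compl
    exact MeasurableSet.iInter fun j => MeasurableSet.iInter fun _ =>
      (measurableSet_eq_fun (measurable_chosen_lam j) (measurable_chosen_lam 0)).compl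
  have hmp := (measurePreserving_piFinSuccAbove (fun _ : Fin (k + 1) => ν) 0).symm
  rw [← hmp.measure_preimage_equiv, Measure.prod_apply_symm (hmp.measurable hNm)]
  refine (lintegral_congr fun x => ?_).trans lintegral_zero
  set e := (chosenEigensystem x).2 0
  have he : ‖e‖ = 1 := (isEigensystem_chosen x).norm_eq_one 0
  have he0 : e ≠ 0 := fun h => by simp [h] at he
  refine measure_mono_null ?_ (hν (volume_setOf_inner_eq he0 (inner ℝ e (sampleMean x))))
  intro x₀ hx₀
  have hx₀' : (Fin.cons x₀ x : Fin (k + 1) → EuclideanSpace ℝ (Fin p)) ∈ N := by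
    have e1 : (MeasurableEquiv.piFinSuccAbove (fun _ : Fin (k + 1) => EuclideanSpace ℝ (Fin p))
        0).symm (x₀, x) = Fin.cons x₀ x := Fin.insertNth_zero' x₀ x
    rw [← e1]
    exact hx₀
  simp only [hN, Set.mem_ofPred_eq, not_or, not_forall, not_not] at hx₀'
  obtain ⟨-, j, hj, hlam⟩ := hx₀'
  have := inner_eq_zero_of_lam_eq hk (isEigensystem_chosen x) (isEigensystem_chosen _) hj hlam
  rw [inner_sub_right, sub_eq_zero] at this
  exact this

end Simple

/-! ### Elliptical distributions -/

section Elliptical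

variable {p : ℕ}

theorem map_withDensity_comp {α β : Type*} [MeasurableSpace α] [MeasurableSpace β] (e : α ≃ᵐ β)
    (μ : Measure α) (g : β → ℝ≥0∞) :
    (μ.withDensity fun x => g (e x)).map e = (μ.map e).withDensity g := by
  ext s hs
  rw [e.map_apply, withDensity_apply _ (e.measurable hs), withDensity_apply _ hs, e.restrict_map,
    lintegral_map_equiv]

theorem mahalanobis_one (x : EuclideanSpace ℝ (Fin p)) : mahalanobis 0 1 x = ‖x‖ := by
  simp only [mahalanobis, sub_zero, inv_one, Matrix.one_mulVec]
  rw [dotProduct_ofLp, real_inner_self_eq_norm_sq, Real.sqrt_sq (norm_nonneg _)]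

theorem ellipticalMeasure_one (f : ℝ → ℝ) :
    ellipticalMeasure (0 : EuclideanSpace ℝ (Fin p)) 1 f
      = volume.withDensity fun x => ENNReal.ofReal (normalizer p f * f ‖x‖) := by
  simp [ellipticalMeasure, mahalanobis_one]

theorem ellipticalMeasure_absolutelyContinuous (μ : EuclideanSpace ℝ (Fin p))
    (Sig : Matrix (Fin p) (Fin p) ℝ) (f : ℝ → ℝ) : ellipticalMeasure μ Sig f ≪ volume :=
  withDensity_absolutelyContinuous _ _

theorem map_isometry_ellipticalMeasure_one (f : ℝ → ℝ)
    (O : EuclideanSpace ℝ (Fin p) ≃ₗᵢ[ℝ] EuclideanSpace ℝ (Fin p)) :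
    (ellipticalMeasure (0 : EuclideanSpace ℝ (Fin p)) 1 f).map O
      = ellipticalMeasure (0 : EuclideanSpace ℝ (Fin p)) 1 f := by
  have h := map_withDensity_comp O.toMeasurableEquiv volume
    fun x => ENNReal.ofReal (normalizer p f * f ‖x‖)
  simp only [LinearIsometryEquiv.coe_toMeasurableEquiv, LinearIsometryEquiv.norm_map,
    O.measurePreserving.map_eq] at h
  rw [ellipticalMeasure_one, h]

theorem map_toEuclideanLin_ellipticalMeasure_one {A : Matrix (Fin p) (Fin p) ℝ} (hA : A.det ≠ 0)
    {f : ℝ → ℝ} (hf : Measurable f) :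
    (ellipticalMeasure (0 : EuclideanSpace ℝ (Fin p)) 1 f).map A.toEuclideanLin
      = ellipticalMeasure (0 : EuclideanSpace ℝ (Fin p)) (A * Aᵀ) f := by
  have hdet : LinearMap.det A.toEuclideanLin ≠ 0 := by
    simpa [Matrix.toLpLin_eq_toLin] using hA
  let e : EuclideanSpace ℝ (Fin p) ≃ₗ[ℝ] EuclideanSpace ℝ (Fin p) :=
    LinearMap.equivOfDetNeZero A.toEuclideanLin hdet
  have he : ⇑e.toContinuousLinearEquiv.toHomeomorph.toMeasurableEquiv = A.toEuclideanLin := rfl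
  have hAu : IsUnit A.det := isUnit_iff_ne_zero.2 hA
  have hAu' : IsUnit Aᵀ.det := by rwa [Matrix.det_transpose]
  have hmah : ∀ x : EuclideanSpace ℝ (Fin p),
      mahalanobis 0 (A * Aᵀ) (A.toEuclideanLin x) = ‖x‖ := by
    intro x
    have h1 : (A.toEuclideanLin x).ofLp = A *ᵥ x.ofLp := by simp
    have h2 : (Aᵀ⁻¹ * A⁻¹) *ᵥ (A *ᵥ x.ofLp) = Aᵀ⁻¹ *ᵥ x.ofLp := by
      rw [Matrix.mulVec_mulVec, Matrix.mul_assoc, Matrix.nonsing_inv_mul _ hAu, Matrix.mul_one]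
    rw [mahalanobis, sub_zero, Matrix.mul_inv_rev, h1, h2, Matrix.dotProduct_mulVec,
      ← Matrix.vecMul_transpose, Matrix.vecMul_vecMul, Matrix.mul_nonsing_inv _ hAu',
      Matrix.vecMul_one, dotProduct_ofLp, real_inner_self_eq_norm_sq, Real.sqrt_sq (norm_nonneg _)]
  have hmahm : Measurable fun x : EuclideanSpace ℝ (Fin p) => mahalanobis 0 (A * Aᵀ) x := by
    have : Continuous fun x : EuclideanSpace ℝ (Fin p) => mahalanobis 0 (A * Aᵀ) x := by
      simp only [mahalanobis]
      fun_prop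
    exact this.measurable
  have h := map_withDensity_comp e.toContinuousLinearEquiv.toHomeomorph.toMeasurableEquiv volume
    fun x => ENNReal.ofReal (normalizer p f * f (mahalanobis 0 (A * Aᵀ) x))
  rw [he] at h
  simp only [hmah] at h
  rw [ellipticalMeasure_one, h, Measure.map_linearMap_addHaar_eq_smul_addHaar _ hdet,
    withDensity_smul_measure, ellipticalMeasure, ← withDensity_smul]
  · congr 1
    funext x
    rw [Pi.smul_apply, smul_eq_mul, ← ENNReal.ofReal_mul (abs_nonneg _)]
    congr 1
    have hd : √(A * Aᵀ).det = |A.det| := by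
      rw [Matrix.det_mul, Matrix.det_transpose, Real.sqrt_mul_self_eq_abs]
    have hd2 : LinearMap.det A.toEuclideanLin = A.det := by
      simp [Matrix.toLpLin_eq_toLin]
    rw [hd, hd2, abs_inv]
    ring
  · exact ((hf.comp hmahm).const_mul _).ennreal_ofReal

theorem map_spiked_ellipticalMeasure_one {θ : EuclideanSpace ℝ (Fin p)} (hθ : ‖θ‖ = 1)
    {r v s : ℝ} (hs0 : s ≠ 0) (hs : s ^ 2 = 1 + r * v) {f : ℝ → ℝ} (hf : Measurable f) :
    (ellipticalMeasure (0 : EuclideanSpace ℝ (Fin p)) 1 f).map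
        (spikedCov θ 1 (s - 1)).toEuclideanLin
      = ellipticalMeasure (0 : EuclideanSpace ℝ (Fin p)) (spikedCov θ r v) f := by
  rw [map_toEuclideanLin_ellipticalMeasure_one ?_ hf, spikedCov_transpose, spikedCov_mul_self hθ hs]
  rw [det_spikedCov hθ]
  simpa using hs0

theorem map_inner_ellipticalMeasure_one (f : ℝ → ℝ) {a b : EuclideanSpace ℝ (Fin p)}
    (hab : ‖a‖ = ‖b‖) :
    (ellipticalMeasure (0 : EuclideanSpace ℝ (Fin p)) 1 f).map (inner ℝ a)
      = (ellipticalMeasure (0 : EuclideanSpace ℝ (Fin p)) 1 f).map (inner ℝ b) := by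
  set O := (ℝ ∙ (b - a))ᗮ.reflection with hO
  have hOb : O b = a := Submodule.reflection_sub hab.symm
  conv_rhs => rw [← map_isometry_ellipticalMeasure_one f O.symm]
  rw [Measure.map_map (by fun_prop) (by fun_prop)]
  congr 1
  funext x
  rw [Function.comp_apply, ← O.inner_map_map b (O.symm x), O.apply_symm_apply, hOb]

end Elliptical

/-! ### Moments of spherical distributions -/

/-- The moment structure, up to order four, of a spherical distribution with identity covariance:
`3 m` is the fourth moment of its one-dimensional projections. -/
structure HasSphericalMoments {p : ℕ} (ν : Measure (EuclideanSpace ℝ (Fin p))) (m : ℝ) : Prop where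
  pos : 0 < m
  integrable_norm_pow_four : Integrable (fun x : EuclideanSpace ℝ (Fin p) => ‖x‖ ^ 4) ν
  integral_inner : ∀ a : EuclideanSpace ℝ (Fin p), ∫ x, inner ℝ a x ∂ν = 0
  integral_inner_sq : ∀ a : EuclideanSpace ℝ (Fin p), ∫ x, inner ℝ a x ^ 2 ∂ν = ‖a‖ ^ 2
  integral_inner_sq_mul_sq : ∀ a b : EuclideanSpace ℝ (Fin p), inner ℝ a b = 0 →
    ∫ x, inner ℝ a x ^ 2 * inner ℝ b x ^ 2 ∂ν = m * (‖a‖ ^ 2 * ‖b‖ ^ 2)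
  integral_norm_pow_four : ∫ x, ‖x‖ ^ 4 ∂ν = p * (p + 2) * m

section Moments

variable {p : ℕ} {ν : Measure (EuclideanSpace ℝ (Fin p))}

theorem memLp_inner_four (h : Integrable (fun x => ‖x‖ ^ 4) ν) (a : EuclideanSpace ℝ (Fin p)) :
    MemLp (fun x : EuclideanSpace ℝ (Fin p) => inner ℝ a x) 4 ν := by
  have h1 : MemLp (fun x : EuclideanSpace ℝ (Fin p) => ‖x‖) 4 ν := by
    rw [← integrable_norm_rpow_iff (by fun_prop) (by norm_num) (by norm_num)]
    simpa using h
  refine MemLp.of_le_mul (c := ‖a‖) h1 (by fun_prop) (.of_forall fun x => ?_)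
  simpa using abs_real_inner_le_norm a x

theorem integrable_inner_pow_four (h : Integrable (fun x => ‖x‖ ^ 4) ν)
    (a : EuclideanSpace ℝ (Fin p)) : Integrable (fun x => inner ℝ a x ^ 4) ν := by
  have := (memLp_inner_four h a).integrable_norm_pow (p := 4) (by norm_num)
  refine this.congr (.of_forall fun x => ?_)
  simp [Even.pow_abs (by decide : Even 4)]

theorem integrable_inner_sq_mul_sq (h : Integrable (fun x => ‖x‖ ^ 4) ν)
    (a b : EuclideanSpace ℝ (Fin p)) :
    Integrable (fun x => inner ℝ a x ^ 2 * inner ℝ b x ^ 2) ν := by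
  refine ((integrable_inner_pow_four h a).add (integrable_inner_pow_four h b)).mono'
    (by fun_prop) (.of_forall fun x => ?_)
  simp only [Pi.add_apply]
  rw [Real.norm_of_nonneg (by positivity)]
  nlinarith [sq_nonneg (inner ℝ a x ^ 2 - inner ℝ b x ^ 2), sq_nonneg (inner ℝ a x ^ 2),
    sq_nonneg (inner ℝ b x ^ 2)]

theorem integral_inner_sq_mul_sq_of_pow_four (h : Integrable (fun x => ‖x‖ ^ 4) ν) {m : ℝ}
    (h4 : ∀ a, ∫ x, inner ℝ a x ^ 4 ∂ν = 3 * m * ‖a‖ ^ 4) {a b : EuclideanSpace ℝ (Fin p)}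
    (hab : inner ℝ a b = 0) :
    ∫ x, inner ℝ a x ^ 2 * inner ℝ b x ^ 2 ∂ν = m * (‖a‖ ^ 2 * ‖b‖ ^ 2) := by
  have ha := integrable_inner_pow_four h a
  have hb := integrable_inner_pow_four h b
  have hp := integrable_inner_pow_four h (a + b)
  have hm := integrable_inner_pow_four h (a - b)
  have e : ∀ x, inner ℝ a x ^ 2 * inner ℝ b x ^ 2 = (inner ℝ (a + b) x ^ 4
      + inner ℝ (a - b) x ^ 4 - 2 * inner ℝ a x ^ 4 - 2 * inner ℝ b x ^ 4) / 12 := by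
    intro x
    rw [inner_add_left, inner_sub_left]; ring
  simp_rw [e]
  rw [integral_div, integral_sub (by fun_prop) (by fun_prop), integral_sub (by fun_prop)
    (by fun_prop), integral_add hp hm, integral_const_mul, integral_const_mul, h4, h4, h4, h4]
  have hn1 : ‖a + b‖ ^ 2 = ‖a‖ ^ 2 + ‖b‖ ^ 2 := by
    rw [norm_add_sq_real, hab]; ring
  have hn2 : ‖a - b‖ ^ 2 = ‖a‖ ^ 2 + ‖b‖ ^ 2 := by
    rw [norm_sub_sq_real, hab]; ring
  have e1 : ‖a + b‖ ^ 4 = (‖a‖ ^ 2 + ‖b‖ ^ 2) ^ 2 := by rw [← hn1]; ring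
  have e2 : ‖a - b‖ ^ 4 = (‖a‖ ^ 2 + ‖b‖ ^ 2) ^ 2 := by rw [← hn2]; ring
  rw [e1, e2]; ring

theorem integral_norm_pow_four_of_pow_four (h : Integrable (fun x => ‖x‖ ^ 4) ν) {m : ℝ}
    (h4 : ∀ a, ∫ x, inner ℝ a x ^ 4 ∂ν = 3 * m * ‖a‖ ^ 4) :
    ∫ x, ‖x‖ ^ 4 ∂ν = p * (p + 2) * m := by
  set b := EuclideanSpace.basisFun (Fin p) ℝ
  have e : ∀ x : EuclideanSpace ℝ (Fin p),
      ‖x‖ ^ 4 = ∑ i, ∑ j, inner ℝ (b i) x ^ 2 * inner ℝ (b j) x ^ 2 := by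
    intro x
    rw [← Finset.sum_mul_sum, b.sum_sq_inner_right]; ring
  simp_rw [e]
  rw [integral_finsetSum _ fun i _ => integrable_finsetSum _ fun j _ =>
    integrable_inner_sq_mul_sq h _ _]
  have hij : ∀ i j, ∫ x, inner ℝ (b i) x ^ 2 * inner ℝ (b j) x ^ 2 ∂ν
      = m + if i = j then 2 * m else 0 := by
    intro i j
    split_ifs with hij
    · subst hij
      have := h4 (b i)
      rw [b.norm_eq_one] at this
      rw [show m + 2 * m = 3 * m * 1 ^ 4 by ring, ← this]
      exact integral_congr_ae (.of_forall fun x => by ring)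
    · rw [integral_inner_sq_mul_sq_of_pow_four h h4 (b.inner_eq_zero hij), b.norm_eq_one,
        b.norm_eq_one]
      ring
  simp_rw [integral_finsetSum _ fun j _ => integrable_inner_sq_mul_sq h _ _, hij]
  simp [Finset.sum_add_distrib]
  ring

end Moments

theorem IsRadialDensityFour.integrable_norm_pow_four {p : ℕ} [NeZero p] {f : ℝ → ℝ}
    (hf : IsRadialDensityFour p f) :
    Integrable (fun x : EuclideanSpace ℝ (Fin p) => ‖x‖ ^ 4) (ellipticalMeasure 0 1 f) := by
  have hp := NeZero.ne p
  have : Nontrivial (EuclideanSpace ℝ (Fin p)) :=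
    Module.nontrivial_of_finrank_pos (R := ℝ) (by simp; omega)
  have hm := hf.measurable
  have hrad : IntegrableOn (fun r => r ^ (p + 3) * f r) (Set.Ioi 0) := by
    have := hf.radialMoment_lt_top.ne
    rw [radialMoment, lintegral_ofReal_ne_top_iff_integrable] at this
    · exact this
    · exact (by fun_prop : Measurable fun r => r ^ (p + 3) * f r).aestronglyMeasurable
    · filter_upwards [ae_restrict_mem measurableSet_Ioi] with r hr
      exact mul_nonneg (pow_nonneg (le_of_lt hr) _) (hf.nonneg r (le_of_lt hr))
  have hc : 0 ≤ normalizer p f := inv_nonneg.2 (integral_nonneg fun x => hf.nonneg _ (norm_nonneg _))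
  rw [ellipticalMeasure_one, integrable_withDensity_iff (by fun_prop) (.of_forall fun _ =>
    ENNReal.ofReal_lt_top)]
  refine (integrable_fun_norm_addHaar volume
    (f := fun r => r ^ 4 * (ENNReal.ofReal (normalizer p f * f r)).toReal)).2 ?_
  refine (hrad.const_mul (normalizer p f)).congr ?_
  filter_upwards [ae_restrict_mem measurableSet_Ioi] with r hr
  rw [ENNReal.toReal_ofReal (mul_nonneg hc (hf.nonneg r (le_of_lt hr)))]
  simp only [finrank_euclideanSpace, Fintype.card_fin, smul_eq_mul]
  rw [show p + 3 = p - 1 + 4 by omega, pow_add]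
  ring

theorem IsRadialDensityFour.exists_hasSphericalMoments {p : ℕ} [NeZero p] {f : ℝ → ℝ}
    (hf : IsRadialDensityFour p f) :
    ∃ m, HasSphericalMoments (ellipticalMeasure (0 : EuclideanSpace ℝ (Fin p)) 1 f) m := by
  have := hf.isProbabilityMeasure
  set ν := ellipticalMeasure (0 : EuclideanSpace ℝ (Fin p)) 1 f with hν
  have hint := hf.integrable_norm_pow_four
  set e : EuclideanSpace ℝ (Fin p) := EuclideanSpace.basisFun (Fin p) ℝ 0 with he
  have he1 : ‖e‖ = 1 := OrthonormalBasis.norm_eq_one _ _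
  have hex : ∀ x, inner ℝ e x = x 0 := fun x => EuclideanSpace.basisFun_inner (Fin p) ℝ x 0
  have hproj : ∀ (k : ℕ) (a : EuclideanSpace ℝ (Fin p)),
      ∫ x, inner ℝ a x ^ k ∂ν = ‖a‖ ^ k * ∫ x, inner ℝ e x ^ k ∂ν := by
    intro k a
    have h1 : ‖a‖ = ‖‖a‖ • e‖ := by simp [norm_smul, he1]
    have h2 : ∀ b : EuclideanSpace ℝ (Fin p),
        ∫ x, inner ℝ b x ^ k ∂ν = ∫ t, t ^ k ∂(ν.map (inner ℝ b)) := fun b => by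
      rw [integral_map (by fun_prop) (by fun_prop)]
    rw [h2 a, map_inner_ellipticalMeasure_one f h1, ← h2, ← integral_const_mul]
    refine integral_congr_ae (.of_forall fun x => ?_)
    simp only [inner_smul_left, mul_pow]
    simp
  have hmean : ∀ a : EuclideanSpace ℝ (Fin p), ∫ x, inner ℝ a x ∂ν = 0 := by
    intro a
    have h1 := hproj 1 (-a)
    have h2 := hproj 1 a
    simp only [pow_one, norm_neg, inner_neg_left] at h1 h2
    rw [integral_neg] at h1
    linarith
  have hL2 : ∀ i : Fin p, MemLp (fun x : EuclideanSpace ℝ (Fin p) => x i) 2 ν := hf.memLp_two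
  have hsq : ∫ x, inner ℝ e x ^ 2 ∂ν = 1 := by
    have hcov := hf.covariance_eq 0 0
    rw [covariance_eq_sub (hL2 0) (hL2 0)] at hcov
    have h0 : ν[fun x : EuclideanSpace ℝ (Fin p) => x 0] = 0 := by
      rw [← hmean e]
      exact integral_congr_ae (.of_forall fun x => (hex x).symm)
    rw [h0, Matrix.one_apply_eq, mul_zero, sub_zero] at hcov
    rw [← hcov]
    refine integral_congr_ae (.of_forall fun x => ?_)
    simp [hex, sq]
  set m := (∫ x, inner ℝ e x ^ 4 ∂ν) / 3 with hm
  have h4 : ∀ a, ∫ x, inner ℝ a x ^ 4 ∂ν = 3 * m * ‖a‖ ^ 4 := by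
    intro a
    rw [hproj 4 a, hm]; ring
  refine ⟨m, ⟨?_, hint, hmean, fun a => ?_, fun a b hab =>
    integral_inner_sq_mul_sq_of_pow_four hint h4 hab, integral_norm_pow_four_of_pow_four hint h4⟩⟩
  · have hi4 := integrable_inner_pow_four hint e
    have hi2 : Integrable (fun x => inner ℝ e x ^ 2) ν := by
      refine (hi4.add (integrable_const 1)).mono' (by fun_prop) (.of_forall fun x => ?_)
      rw [Real.norm_of_nonneg (by positivity)]
      simp only [Pi.add_apply]
      nlinarith [sq_nonneg (inner ℝ e x ^ 2 - 1), sq_nonneg (inner ℝ e x ^ 2)]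
    have h0 : 0 ≤ ∫ x, (inner ℝ e x ^ 4 - 2 * inner ℝ e x ^ 2 + 1) ∂ν :=
      integral_nonneg fun x => by
        simp only [Pi.zero_apply]
        nlinarith [sq_nonneg (inner ℝ e x ^ 2 - 1)]
    rw [integral_add (by fun_prop) (by fun_prop), integral_sub (by fun_prop) (by fun_prop),
      integral_const_mul, hsq] at h0
    simp at h0
    rw [hm]
    linarith
  · rw [hproj 2 a, hsq, mul_one]

/-! ### The Gaussian radial density -/

section Gaussian

variable {p : ℕ}

theorem measurable_gaussianRadial : Measurable gaussianRadial := by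
  unfold gaussianRadial
  fun_prop

theorem ellipticalMeasure_one_gaussianRadial :
    ellipticalMeasure (0 : EuclideanSpace ℝ (Fin p)) 1 gaussianRadial
      = stdGaussian (EuclideanSpace ℝ (Fin p)) := by
  have hform : ∀ x : EuclideanSpace ℝ (Fin p),
      gaussianRadial ‖x‖ = Real.exp (-(1 / 2) * ‖x‖ ^ 2) := fun x => by
    rw [gaussianRadial]; ring_nf
  have hnorm : normalizer p gaussianRadial = ((Real.pi / (1 / 2)) ^ ((p : ℝ) / 2))⁻¹ := by
    rw [normalizer]
    simp_rw [hform]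
    rw [GaussianFourier.integral_rexp_neg_mul_sq_norm (by norm_num)]
    simp
  have hpos : 0 < (Real.pi / (1 / 2)) ^ ((p : ℝ) / 2) := by positivity
  have hmeas : Measurable fun x : EuclideanSpace ℝ (Fin p) =>
      ENNReal.ofReal (normalizer p gaussianRadial * gaussianRadial ‖x‖) :=
    ((measurable_gaussianRadial.comp measurable_norm).const_mul _).ennreal_ofReal
  have hlint : ∫⁻ x : EuclideanSpace ℝ (Fin p),
      ENNReal.ofReal (normalizer p gaussianRadial * gaussianRadial ‖x‖) ≠ ∞ := by
    have hi : Integrable fun x : EuclideanSpace ℝ (Fin p) =>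
        Real.exp (-(1 / 2) * ‖x‖ ^ 2) := by
      refine Integrable.of_integral_ne_zero ?_
      rw [GaussianFourier.integral_rexp_neg_mul_sq_norm (by norm_num)]
      simpa using hpos.ne'
    have := (hi.const_mul (normalizer p gaussianRadial)).lintegral_lt_top
    simp_rw [hform]
    exact this.ne
  have : IsFiniteMeasure (ellipticalMeasure (0 : EuclideanSpace ℝ (Fin p)) 1 gaussianRadial) := by
    rw [ellipticalMeasure_one]
    exact isFiniteMeasure_withDensity hlint
  refine Measure.ext_of_charFun (funext fun t => ?_)
  rw [charFun_stdGaussian, charFun_apply, ellipticalMeasure_one,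
    integral_withDensity_eq_integral_toReal_smul hmeas (.of_forall fun _ => ENNReal.ofReal_lt_top)]
  have hint : ∀ x : EuclideanSpace ℝ (Fin p),
      (ENNReal.ofReal (normalizer p gaussianRadial * gaussianRadial ‖x‖)).toReal •
        Complex.exp ((inner ℝ x t : ℝ) * Complex.I)
      = (normalizer p gaussianRadial : ℂ) *
        Complex.exp (-(1 / 2 : ℂ) * ‖x‖ ^ 2 + Complex.I * (inner ℝ t x : ℝ)) := by
    intro x
    rw [ENNReal.toReal_ofReal, hform, Complex.real_smul, Complex.exp_add, real_inner_comm]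
    · push_cast
      rw [mul_comm Complex.I]
      ring
    · rw [hnorm, hform]; positivity
  simp_rw [hint]
  rw [integral_const_mul, GaussianFourier.integral_cexp_neg_mul_sq_norm_add (by norm_num), hnorm]
  have hc : (Real.pi / (1 / 2 : ℂ)) ^ ((Module.finrank ℝ (EuclideanSpace ℝ (Fin p)) : ℂ) / 2)
      = (((Real.pi / (1 / 2)) ^ ((p : ℝ) / 2) : ℝ) : ℂ) := by
    rw [Complex.ofReal_cpow (by positivity)]
    simp
  rw [hc, ← mul_assoc, ← Complex.ofReal_mul, inv_mul_cancel₀ hpos.ne', Complex.ofReal_one, one_mul]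
  congr 1
  rw [Complex.I_sq]
  ring

theorem isRadialDensityFour_gaussianRadial : IsRadialDensityFour p gaussianRadial where
  measurable := measurable_gaussianRadial
  nonneg _ _ := (Real.exp_pos _).le
  isProbabilityMeasure := by
    rw [ellipticalMeasure_one_gaussianRadial]; infer_instance
  memLp_two i := by
    rw [ellipticalMeasure_one_gaussianRadial]
    exact IsGaussian.memLp_dual (stdGaussian (EuclideanSpace ℝ (Fin p)))
      (EuclideanSpace.proj (𝕜 := ℝ) i) 2 (by norm_num)
  covariance_eq i j := by
    rw [ellipticalMeasure_one_gaussianRadial, ← multivariateGaussian_zero_one]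
    exact covariance_eval_multivariateGaussian Matrix.PosSemidef.one i j
  radialMoment_lt_top := by
    have h := integrableOn_rpow_mul_exp_neg_mul_sq (b := 1 / 2) (by norm_num) (s := (p + 3 : ℕ))
      (by have := Nat.cast_nonneg (α := ℝ) (p + 3); linarith)
    rw [radialMoment]
    refine lt_of_le_of_lt (le_of_eq ?_) h.lintegral_lt_top
    refine lintegral_congr fun r => ?_
    rw [Real.rpow_natCast, gaussianRadial]
    ring_nf

theorem eq_one_of_hasSphericalMoments_gaussianRadial (hp : 2 ≤ p) {m : ℝ}
    (h : HasSphericalMoments (ellipticalMeasure (0 : EuclideanSpace ℝ (Fin p)) 1 gaussianRadial) m) :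
    m = 1 := by
  set b := EuclideanSpace.basisFun (Fin p) ℝ
  let i : Fin p := ⟨0, by omega⟩
  let j : Fin p := ⟨1, by omega⟩
  have hij : i ≠ j := by simp [i, j]
  have h1 := h.integral_inner_sq_mul_sq (b i) (b j) (b.inner_eq_zero hij)
  have hb : ∀ k x, inner ℝ (b k) x = x k := fun k x => EuclideanSpace.basisFun_inner (Fin p) ℝ x k
  rw [b.norm_eq_one, b.norm_eq_one, ellipticalMeasure_one_gaussianRadial,
    ← map_pi_eq_stdGaussian, integral_map (by fun_prop) (by fun_prop)] at h1
  simp only [hb] at h1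
  have hsq : ∫ t, t ^ 2 ∂(gaussianReal 0 1) = 1 := by
    have := variance_id_gaussianReal (μ := 0) (v := 1)
    rw [variance_eq_sub (memLp_id_gaussianReal 2)] at this
    simpa using this
  have hprod : ∀ z : Fin p → ℝ, z i ^ 2 * z j ^ 2
      = ∏ k, (if k = i ∨ k = j then (z k) ^ 2 else 1) := by
    intro z
    rw [Finset.prod_ite, Finset.prod_const_one, mul_one]
    have : ({k | k = i ∨ k = j} : Finset (Fin p)) = {i, j} := by ext; simp
    rw [this, Finset.prod_pair hij]
  rw [integral_congr_ae (.of_forall hprod)] at h1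
  rw [integral_fintype_prod_eq_prod (f := fun k t => if k = i ∨ k = j then t ^ 2 else (1 : ℝ))] at h1
  have hone : ∀ k, ∫ t, (if k = i ∨ k = j then t ^ 2 else (1 : ℝ)) ∂(gaussianReal 0 1) = 1 := by
    intro k
    split_ifs
    · exact hsq
    · simp
  rw [Finset.prod_eq_one fun k _ => hone k] at h1
  simpa using h1.symm

end Gaussian

/-! ### Convergence in distribution -/

section Convergence

/-- Convergence in distribution to `0` implies convergence in probability. -/
theorem tendsto_measure_norm_ge_of_tendstoInDistribution_zero {ι E Ω' : Type*} {Ω : ι → Type*}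
    {m : ∀ i, MeasurableSpace (Ω i)} {μ : ∀ i, Measure (Ω i)} [∀ i, IsProbabilityMeasure (μ i)]
    {m' : MeasurableSpace Ω'} {μ' : Measure Ω'} [IsProbabilityMeasure μ']
    [NormedAddCommGroup E] [MeasurableSpace E] [BorelSpace E] {X : ∀ i, Ω i → E} {l : Filter ι}
    (h : TendstoInDistribution X l (fun _ : Ω' => (0 : E)) μ μ') {ε : ℝ} (hε : 0 < ε) :
    Tendsto (fun i => μ i {ω | ε ≤ ‖X i ω‖}) l (𝓝 0) := by
  have hclosed : IsClosed {x : E | ε ≤ ‖x‖} := isClosed_le (by fun_prop) (by fun_prop)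
  have hnull : μ'.map (fun _ : Ω' => (0 : E)) {x : E | ε ≤ ‖x‖} = 0 := by
    rw [Measure.map_apply (by fun_prop) hclosed.measurableSet]
    have : {a : Ω' | ε ≤ ‖(0 : E)‖} = ∅ := by ext; simp [hε]
    exact (congrArg μ' this).trans measure_empty
  have hfr : μ'.map (fun _ : Ω' => (0 : E)) (frontier {x : E | ε ≤ ‖x‖}) = 0 :=
    measure_mono_null hclosed.frontier_subset hnull
  have key := ProbabilityMeasure.tendsto_measure_of_null_frontier_of_tendsto' h.tendsto hfr
  simp only [ProbabilityMeasure.coe_mk, hnull] at key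
  refine key.congr fun i => ?_
  rw [Measure.map_apply_of_aemeasurable (h.forall_aemeasurable i) hclosed.measurableSet]
  rfl

variable {Ω Ω' : Type*} {mΩ : MeasurableSpace Ω} {mΩ' : MeasurableSpace Ω'} {μ : Measure Ω}
  [IsProbabilityMeasure μ] {μ' : Measure Ω'} [IsProbabilityMeasure μ']

theorem tendstoInMeasure_zero_of_tendstoInDistribution {E : Type*} [NormedAddCommGroup E]
    [MeasurableSpace E] [BorelSpace E] {X : ℕ → Ω → E}
    (h : TendstoInDistribution X atTop (fun _ : Ω' => (0 : E)) (fun _ => μ) μ') :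
    TendstoInMeasure μ X atTop 0 := by
  rw [tendstoInMeasure_iff_norm]
  intro ε hε
  simpa using tendsto_measure_norm_ge_of_tendstoInDistribution_zero h hε

/-- A sequence which is negligible with respect to one converging in distribution converges to `0`
in probability. -/
theorem tendstoInMeasure_zero_of_ratio {A B : ℕ → Ω → ℝ} {Z : Ω' → ℝ}
    (hA : TendstoInDistribution A atTop Z (fun _ => μ) μ') (hB : ∀ n, AEMeasurable (B n) μ)
    (h : ∀ᵐ ω ∂μ, Tendsto (fun n => B n ω / (1 + |A n ω|)) atTop (𝓝 0)) :
    TendstoInMeasure μ B atTop 0 := by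
  have hRm : ∀ n, AEMeasurable (fun ω => B n ω / (1 + |A n ω|)) μ := fun n => by
    have := hA.forall_aemeasurable n
    have := hB n
    fun_prop
  have hR : TendstoInMeasure μ (fun n ω => B n ω / (1 + |A n ω|)) atTop fun _ => (0 : ℝ) :=
    tendstoInMeasure_of_tendsto_ae (fun n => (hRm n).aestronglyMeasurable) h
  have hS := hA.continuous_comp_prodMk_of_tendstoInMeasure_const
    (g := fun q : ℝ × ℝ => q.2 * (1 + |q.1|)) (by fun_prop) hR hRm
  simp only [zero_mul] at hS
  refine tendstoInMeasure_zero_of_tendstoInDistribution (μ' := μ') ?_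
  refine hS.congr (fun n => .of_forall fun ω => ?_) (.of_forall fun _ => rfl)
  have : (0 : ℝ) < 1 + |A n ω| := by positivity
  field_simp

theorem tendstoInDistribution_congr_law {ι E Ω'' : Type*} {Ω : ι → Type*}
    {m : ∀ i, MeasurableSpace (Ω i)} {μ : ∀ i, Measure (Ω i)} [∀ i, IsProbabilityMeasure (μ i)]
    {m'' : MeasurableSpace Ω''} {μ'' : Measure Ω''} [IsProbabilityMeasure μ'']
    [TopologicalSpace E] [MeasurableSpace E] [OpensMeasurableSpace E] {X : ∀ i, Ω i → E}
    {l : Filter ι} {Z : Ω' → E} {Z' : Ω'' → E} (h : TendstoInDistribution X l Z μ μ')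
    (hZ' : AEMeasurable Z' μ'') (hlaw : μ'.map Z = μ''.map Z') :
    TendstoInDistribution X l Z' μ μ'' where
  forall_aemeasurable := h.forall_aemeasurable
  aemeasurable_limit := hZ'
  tendsto := by
    have e : (⟨μ''.map Z', Measure.isProbabilityMeasure_map hZ'⟩ : ProbabilityMeasure E)
        = ⟨μ'.map Z, Measure.isProbabilityMeasure_map h.aemeasurable_limit⟩ := Subtype.ext hlaw.symm
    rw [e]
    exact h.tendsto

/-- The **multivariate central limit theorem** for centered vectors with identity covariance. -/
theorem tendstoInDistribution_inv_sqrt_smul_sum {F : Type*} [NormedAddCommGroup F]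
    [InnerProductSpace ℝ F] [FiniteDimensional ℝ F] [MeasurableSpace F] [BorelSpace F]
    {V : ℕ → Ω → F} {ν : Measure F} (hV : ∀ i, HasLaw (V i) ν μ) (hind : iIndepFun V μ)
    (h0 : ∀ t, ∫ x, inner ℝ t x ∂ν = 0) (h1 : ∀ t, ∫ x, inner ℝ t x ^ 2 ∂ν = ‖t‖ ^ 2) :
    TendstoInDistribution (fun (n : ℕ) ω => (√n)⁻¹ • ∑ k ∈ Finset.range n, V k ω) atTop id
      (fun _ => μ) (stdGaussian F) where
  forall_aemeasurable n := by
    have := fun i => (hV i).aemeasurable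
    fun_prop
  tendsto := by
    have hm := fun i => (hV i).aemeasurable
    refine ProbabilityMeasure.tendsto_iff_tendsto_charFun.2 fun t => ?_
    simp only [ProbabilityMeasure.coe_mk, Measure.map_id]
    rw [charFun_stdGaussian]
    rcases eq_or_ne t 0 with rfl | ht
    · have : ∀ n : ℕ, IsProbabilityMeasure
          (μ.map fun ω => (√n)⁻¹ • ∑ k ∈ Finset.range n, V k ω) := fun n =>
        Measure.isProbabilityMeasure_map (by fun_prop)
      simp
    set u : F := ‖t‖⁻¹ • t with hu
    have hu1 : ‖u‖ = 1 := by simp [hu, norm_smul, ht]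
    have hindu : iIndepFun (fun k ω => inner ℝ u (V k ω)) μ :=
      hind.comp (fun _ x => inner ℝ u x) fun _ => by fun_prop
    have hidu : ∀ i, IdentDistrib (fun ω => inner ℝ u (V i ω)) (fun ω => inner ℝ u (V 0 ω)) μ μ :=
      fun i => ((hV i).identDistrib (hV 0)).comp (u := fun x => inner ℝ u x) (by fun_prop)
    have hm0 : AEMeasurable (fun ω => inner ℝ u (V 0 ω)) μ := (hidu 0).aemeasurable_fst
    have e0 : μ[fun ω => inner ℝ u (V 0 ω)] = 0 := by
      rw [← h0 u]
      exact (hV 0).integral_comp (f := fun x => inner ℝ u x) (by fun_prop)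
    have e1 : μ[(fun ω => inner ℝ u (V 0 ω)) ^ 2] = 1 := by
      have := (hV 0).integral_comp (f := fun x => inner ℝ u x ^ 2) (by fun_prop)
      rw [h1, hu1, one_pow] at this
      exact this
    have key := tendsto_charFun_inv_sqrt_mul_pow hm0 e0 e1 ‖t‖
    refine (key.congr fun n => ?_).trans (le_of_eq (by norm_cast))
    have hc := charFun_inv_sqrt_mul_sum hindu hidu (n := n) (t := ‖t‖)
    rw [← hc, charFun_apply, charFun_apply, integral_map (by fun_prop) (by fun_prop),
      integral_map (by fun_prop) (by fun_prop)]
    refine integral_congr_ae (.of_forall fun ω => ?_)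
    simp only
    congr 3
    rw [← inner_sum, ← real_inner_smul_right, hu, real_inner_comm t, real_inner_smul_left]
    simp
    field_simp

end Convergence

/-! ### The chi-square distribution -/

section ChiSquare

theorem chiSquare_eq_map_stdGaussian (k : ℕ) :
    chiSquare k = (stdGaussian (EuclideanSpace ℝ (Fin k))).map fun x => ‖x‖ ^ 2 := by
  rw [← map_pi_eq_stdGaussian, Measure.map_map (by fun_prop) (by fun_prop), chiSquare]
  congr 1
  funext z
  simp [EuclideanSpace.real_norm_sq_eq]

theorem chiSquare_singleton {k : ℕ} (hk : k ≠ 0) (t : ℝ) : chiSquare k {t} = 0 := by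
  have : Nontrivial (EuclideanSpace ℝ (Fin k)) :=
    Module.nontrivial_of_finrank_pos (R := ℝ) (by simp; omega)
  rw [chiSquare_eq_map_stdGaussian, Measure.map_apply (by fun_prop) (measurableSet_singleton t),
    ← ellipticalMeasure_one_gaussianRadial]
  refine ellipticalMeasure_absolutelyContinuous _ _ _ ?_
  refine measure_mono_null (fun x hx => ?_) (Measure.addHaar_sphere volume
    (0 : EuclideanSpace ℝ (Fin k)) √t)
  have hx' : ‖x‖ ^ 2 = t := hx
  rw [mem_sphere_zero_iff_norm, ← hx', Real.sqrt_sq (norm_nonneg _)]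

theorem continuous_cdf_of_measure_singleton {μ : Measure ℝ} [IsProbabilityMeasure μ]
    (h : ∀ t, μ {t} = 0) : Continuous (cdf μ) := by
  refine continuous_iff_continuousAt.2 fun t => ?_
  rw [(monotone_cdf μ).continuousAt_iff_leftLim_eq_rightLim, StieltjesFunction.rightLim_eq]
  refine le_antisymm ((monotone_cdf μ).leftLim_le le_rfl) ?_
  have h1 := h t
  rw [← measure_cdf μ, StieltjesFunction.measure_singleton, ENNReal.ofReal_eq_zero] at h1
  linarith

theorem cdf_chiSquareUpperQuantile {k : ℕ} (hk : k ≠ 0) {α : ℝ} (h0 : 0 < α) (h1 : α < 1) :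
    cdf (chiSquare k) (chiSquareUpperQuantile k α) = 1 - α := by
  have hc := continuous_cdf_of_measure_singleton (chiSquare_singleton hk)
  have hmono := monotone_cdf (chiSquare k)
  obtain ⟨a, ha⟩ := ((tendsto_cdf_atBot (chiSquare k)).eventually_lt_const
    (by linarith : 0 < 1 - α)).exists
  obtain ⟨b, hb⟩ := ((tendsto_cdf_atTop (chiSquare k)).eventually_const_lt
    (by linarith : 1 - α < 1)).exists
  obtain ⟨t, ht⟩ := mem_range_of_exists_le_of_exists_ge hc ⟨a, ha.le⟩ ⟨b, hb.le⟩
  set T := {t : ℝ | 1 - α ≤ cdf (chiSquare k) t} with hT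
  have hbdd : BddBelow T := ⟨a, fun x hx => by
    by_contra! hlt
    exact absurd (hmono hlt.le) (not_le.2 (ha.trans_le hx))⟩
  have htT : t ∈ T := ht.ge
  have hcl : IsClosed T := isClosed_le continuous_const hc
  refine le_antisymm ?_ (hcl.csInf_mem ⟨t, htT⟩ hbdd)
  rw [← ht]
  exact hmono (csInf_le hbdd htT)

theorem tendsto_measure_quantile_lt {Ω : ℕ → Type*} [∀ n, MeasurableSpace (Ω n)]
    {P : ∀ n, Measure (Ω n)} [∀ n, IsProbabilityMeasure (P n)] {T : ∀ n, Ω n → ℝ} {k : ℕ}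
    (hk : k ≠ 0) (hT : TendstoInDistribution T atTop id P (chiSquare k)) {α : ℝ} (h0 : 0 < α)
    (h1 : α < 1) :
    Tendsto (fun n => (P n).real {ω | chiSquareUpperQuantile k α < T n ω}) atTop (𝓝 α) := by
  set q := chiSquareUpperQuantile k α
  have hfr : (chiSquare k).map id (frontier (Set.Ioi q)) = 0 := by
    rw [Measure.map_id, frontier_Ioi]
    exact chiSquare_singleton hk q
  have key := ProbabilityMeasure.tendsto_measure_of_null_frontier_of_tendsto' hT.tendsto hfr
  simp only [ProbabilityMeasure.coe_mk, Measure.map_id] at key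
  have hq : (chiSquare k).real (Set.Ioi q) = α := by
    have h2 := probReal_compl_eq_one_sub (μ := chiSquare k) (measurableSet_Iic (a := q))
    rw [Set.compl_Iic, ← cdf_eq_real, cdf_chiSquareUpperQuantile hk h0 h1] at h2
    rw [h2]; ring
  rw [← hq]
  refine ((ENNReal.tendsto_toReal (measure_ne_top _ _)).comp key).congr fun n => ?_
  rw [Function.comp_apply, Measure.map_apply_of_aemeasurable (hT.forall_aemeasurable n)
    measurableSet_Ioi]
  rfl

end ChiSquare

/-! ### Limits for spherical samples -/

section Sample

variable {p : ℕ} {ν : Measure (EuclideanSpace ℝ (Fin p))} {m : ℝ}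
  {Ω : Type*} {mΩ : MeasurableSpace Ω} {μ : Measure Ω} {Y : ℕ → Ω → EuclideanSpace ℝ (Fin p)}

theorem ae_tendsto_mean (hY : ∀ i, HasLaw (Y i) ν μ) (hind : iIndepFun Y μ)
    {g : EuclideanSpace ℝ (Fin p) → ℝ} (hg : Measurable g) (hi : Integrable g ν) :
    ∀ᵐ ω ∂μ, Tendsto (fun n : ℕ => (n : ℝ)⁻¹ * ∑ i : Fin n, g (Y i ω)) atTop
      (𝓝 (∫ x, g x ∂ν)) := by
  have h := strong_law_ae_real (μ := μ) (fun i ω => g (Y i ω))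
    (by
      rw [← (hY 0).map_eq] at hi
      exact (integrable_map_measure hg.aestronglyMeasurable (hY 0).aemeasurable).1 hi)
    (fun i j hij => (hind.indepFun hij).comp hg hg)
    (fun i => ((hY i).identDistrib (hY 0)).comp hg)
  have e : μ[fun ω => g (Y 0 ω)] = ∫ x, g x ∂ν :=
    (hY 0).integral_comp (f := g) hg.aestronglyMeasurable
  filter_upwards [h] with ω hω
  rw [e] at hω
  refine hω.congr fun n => ?_
  rw [Fin.sum_univ_eq_sum_range (fun i => g (Y i ω)), div_eq_inv_mul]

variable [IsProbabilityMeasure ν]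

theorem HasSphericalMoments.integrable_inner_sq (h : HasSphericalMoments ν m)
    (a : EuclideanSpace ℝ (Fin p)) : Integrable (fun x => inner ℝ a x ^ 2) ν :=
  ((memLp_inner_four h.integrable_norm_pow_four a).mono_exponent (by norm_num)).integrable_sq

theorem HasSphericalMoments.integrable_inner (h : HasSphericalMoments ν m)
    (a : EuclideanSpace ℝ (Fin p)) : Integrable (fun x => inner ℝ a x) ν :=
  (memLp_inner_four h.integrable_norm_pow_four a).integrable (by norm_num)

theorem HasSphericalMoments.integrable_inner_mul (h : HasSphericalMoments ν m)
    (a b : EuclideanSpace ℝ (Fin p)) : Integrable (fun x => inner ℝ a x * inner ℝ b x) ν := by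
  refine ((h.integrable_inner_sq a).add (h.integrable_inner_sq b)).mono' (by fun_prop)
    (.of_forall fun x => ?_)
  simp only [Pi.add_apply]
  rw [Real.norm_eq_abs, abs_mul]
  nlinarith [sq_nonneg (|inner ℝ a x| - |inner ℝ b x|), sq_abs (inner ℝ a x),
    sq_abs (inner ℝ b x), abs_nonneg (inner ℝ a x), abs_nonneg (inner ℝ b x)]

theorem HasSphericalMoments.integral_inner_mul (h : HasSphericalMoments ν m)
    (a b : EuclideanSpace ℝ (Fin p)) : ∫ x, inner ℝ a x * inner ℝ b x ∂ν = inner ℝ a b := by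
  have e : ∀ x, inner ℝ a x * inner ℝ b x
      = (inner ℝ (a + b) x ^ 2 - inner ℝ a x ^ 2 - inner ℝ b x ^ 2) / 2 := fun x => by
    rw [inner_add_left]; ring
  have ha := h.integrable_inner_sq a
  have hb := h.integrable_inner_sq b
  have hab := h.integrable_inner_sq (a + b)
  simp_rw [e]
  rw [integral_div, integral_sub (by fun_prop) (by fun_prop),
    integral_sub (by fun_prop) (by fun_prop), h.integral_inner_sq,
    h.integral_inner_sq, h.integral_inner_sq, norm_add_sq_real]
  ring

theorem ae_tendsto_sample (h : HasSphericalMoments ν m) (hY : ∀ i, HasLaw (Y i) ν μ)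
    (hind : iIndepFun Y μ) :
    ∀ᵐ ω ∂μ, Tendsto (fun n : ℕ => sampleMean fun i : Fin n => Y i ω) atTop (𝓝 0) ∧
      Tendsto (fun n : ℕ => sampleCov fun i : Fin n => Y i ω) atTop (𝓝 1) ∧
      Tendsto (fun n : ℕ => (n : ℝ)⁻¹ * ∑ i : Fin n, ‖Y i ω‖ ^ 4) atTop
        (𝓝 (p * (p + 2) * m)) := by
  set b := EuclideanSpace.basisFun (Fin p) ℝ with hbdef
  have h4 := ae_tendsto_mean hY hind (g := fun x => ‖x‖ ^ 4) (by fun_prop)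
    h.integrable_norm_pow_four
  have h1 := ae_all_iff.2 fun j => ae_tendsto_mean hY hind (g := fun x => inner ℝ (b j) x)
    (by fun_prop) (h.integrable_inner _)
  have h2 := ae_all_iff.2 fun j => ae_all_iff.2 fun k => ae_tendsto_mean hY hind
    (g := fun x => inner ℝ (b j) x * inner ℝ (b k) x) (by fun_prop) (h.integrable_inner_mul _ _)
  have hb : ∀ j x, inner ℝ (b j) x = x j := fun j x => EuclideanSpace.basisFun_inner (Fin p) ℝ x j
  filter_upwards [h4, h1, h2] with ω h4 h1 h2
  simp only [h.integral_inner] at h1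
  simp only [h.integral_inner_mul] at h2
  rw [h.integral_norm_pow_four] at h4
  have hmean : ∀ j, Tendsto (fun n : ℕ => inner ℝ (b j) (sampleMean fun i : Fin n => Y i ω)) atTop
      (𝓝 0) := fun j => (h1 j).congr fun n => (inner_sampleMean _ _).symm
  refine ⟨?_, ?_, h4⟩
  · have : Tendsto (fun n : ℕ => ∑ j, inner ℝ (b j) (sampleMean fun i : Fin n => Y i ω) • b j)
        atTop (𝓝 (∑ j, (0 : ℝ) • b j)) :=
      tendsto_finsetSum _ fun j _ => (hmean j).smul_const _
    simpa [OrthonormalBasis.sum_repr', -EuclideanSpace.basisFun_inner,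
      -EuclideanSpace.basisFun_apply] using this
  · refine tendsto_pi_nhds.2 fun j => tendsto_pi_nhds.2 fun k => ?_
    have hcov := (h2 j k).sub ((hmean j).mul (hmean k))
    have e1 : inner ℝ (b j) (b k) - 0 * 0 = (1 : Matrix (Fin p) (Fin p) ℝ) j k := by
      rw [b.inner_eq_ite, Matrix.one_apply]; simp
    rw [e1] at hcov
    refine hcov.congr fun n => ?_
    rw [← inner_sampleCov_eq_sub, hb]
    simp [hbdef, Matrix.mulVec_single]

theorem exists_orthonormal_complement [NeZero p] {θ₀ : EuclideanSpace ℝ (Fin p)} (hθ₀ : ‖θ₀‖ = 1) :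
    ∃ e : Fin (p - 1) → EuclideanSpace ℝ (Fin p), Orthonormal ℝ e ∧ (∀ k, inner ℝ θ₀ (e k) = 0) ∧
      ∀ w, ∑ k, inner ℝ (e k) w ^ 2 = ‖w‖ ^ 2 - inner ℝ θ₀ w ^ 2 := by
  obtain ⟨k, rfl⟩ : ∃ k, p = k + 1 := ⟨p - 1, by have := NeZero.ne p; omega⟩
  have hv : Orthonormal ℝ (Set.domRestrict {(0 : Fin (k + 1))} fun _ => θ₀) := by
    refine ⟨fun i => hθ₀, fun i j hij => (hij (Subtype.ext ?_)).elim⟩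
    rw [i.2, j.2]
  obtain ⟨b, hb⟩ := hv.exists_orthonormalBasis_extension_of_card_eq (by simp)
  have hb0 : b 0 = θ₀ := hb 0 rfl
  refine ⟨fun i => b i.succ, b.orthonormal.comp _ (Fin.succ_injective k), fun i => ?_, fun w => ?_⟩
  · rw [← hb0]
    exact b.inner_eq_zero (Fin.succ_ne_zero i).symm
  · rw [← b.sum_sq_inner_right w, Fin.sum_univ_succ, hb0]
    simp

/-- The limit distribution of the residual of the sample covariance matrix. -/
theorem tendstoInDistribution_residualSq [IsProbabilityMeasure μ] [NeZero p] (h : HasSphericalMoments ν m)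
    (hY : ∀ i, HasLaw (Y i) ν μ) (hind : iIndepFun Y μ) {θ₀ : EuclideanSpace ℝ (Fin p)}
    (hθ₀ : ‖θ₀‖ = 1) :
    TendstoInDistribution (fun (n : ℕ) ω => n * residualSq θ₀ (fun i : Fin n => Y i ω) / m) atTop id
      (fun _ => μ) (chiSquare (p - 1)) := by
  obtain ⟨e, he, he0, hesum⟩ := exists_orthonormal_complement hθ₀
  have hm := h.pos
  have hYm := fun i => (hY i).aemeasurable
  set g : EuclideanSpace ℝ (Fin p) → EuclideanSpace ℝ (Fin (p - 1)) :=
    fun x => WithLp.toLp 2 fun k => inner ℝ θ₀ x * inner ℝ (e k) x / √m with hg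
  have hgm : Measurable g := by fun_prop
  have hgi : ∀ t x, inner ℝ t (g x) = inner ℝ θ₀ x * inner ℝ (∑ k, t k • e k) x / √m := by
    intro t x
    rw [← dotProduct_ofLp, sum_inner, dotProduct, Finset.mul_sum, Finset.sum_div]
    refine Finset.sum_congr rfl fun k _ => ?_
    rw [real_inner_smul_left]
    simp only [hg]
    ring
  have horth : ∀ t : EuclideanSpace ℝ (Fin (p - 1)), inner ℝ θ₀ (∑ k, t k • e k) = 0 := fun t => by
    simp [inner_sum, inner_smul_right, he0]
  have hnorm : ∀ t : EuclideanSpace ℝ (Fin (p - 1)), ‖∑ k, t k • e k‖ ^ 2 = ‖t‖ ^ 2 := fun t => by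
    rw [← real_inner_self_eq_norm_sq, he.inner_sum, EuclideanSpace.real_norm_sq_eq]
    exact Finset.sum_congr rfl fun k _ => by simp [sq]
  have hW := tendstoInDistribution_inv_sqrt_smul_sum (V := fun i ω => g (Y i ω)) (ν := ν.map g)
    (μ := μ) (fun i => ⟨by fun_prop, by
      rw [← (hY i).map_eq, AEMeasurable.map_map_of_aemeasurable (by fun_prop) (hYm i)]; rfl⟩)
    (hind.comp (fun _ => g) fun _ => hgm)
    (fun t => by
      rw [integral_map (by fun_prop) (by fun_prop)]
      simp_rw [hgi]
      rw [integral_div, h.integral_inner_mul, horth, zero_div])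
    (fun t => by
      rw [integral_map (by fun_prop) (by fun_prop)]
      simp_rw [hgi, div_pow, mul_pow]
      rw [integral_div, h.integral_inner_sq_mul_sq _ _ (horth t), hθ₀, hnorm,
        Real.sq_sqrt hm.le]
      field_simp)
  set W : ℕ → Ω → EuclideanSpace ℝ (Fin (p - 1)) :=
    fun n ω => (√n)⁻¹ • ∑ k ∈ Finset.range n, g (Y k ω) with hWdef
  -- the contribution of the sample mean is negligible
  have hN := tendstoInDistribution_inv_sqrt_mul_sum (P := μ) (P' := gaussianReal 0 1) (Y := id)
    (X := fun i ω => inner ℝ θ₀ (Y i ω)) HasLaw.id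
    (by
      have := (hY 0).integral_comp (f := fun x => inner ℝ θ₀ x) (by fun_prop)
      rw [h.integral_inner] at this
      exact this)
    (by
      have := (hY 0).integral_comp (f := fun x => inner ℝ θ₀ x ^ 2) (by fun_prop)
      rw [h.integral_inner_sq, hθ₀, one_pow] at this
      exact this)
    (hind.comp (fun _ x => inner ℝ θ₀ x) fun _ => by fun_prop)
    (fun i => ((hY i).identDistrib (hY 0)).comp (u := fun x => inner ℝ θ₀ x) (by fun_prop))
  set N : ℕ → Ω → ℝ := fun n ω => (√n)⁻¹ * ∑ k ∈ Finset.range n, inner ℝ θ₀ (Y k ω) with hNdef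
  have hmeanm : ∀ n : ℕ, AEMeasurable (fun ω => sampleMean fun i : Fin n => Y i ω) μ := fun n =>
    (continuous_sampleMean.measurable).comp_aemeasurable
      (aemeasurable_pi_lambda _ fun i => hYm i)
  let π : EuclideanSpace ℝ (Fin p) → EuclideanSpace ℝ (Fin (p - 1)) :=
    fun x => WithLp.toLp 2 fun k => inner ℝ (e k) x / √m
  have hπ : Continuous π := by fun_prop
  set U : ℕ → Ω → EuclideanSpace ℝ (Fin (p - 1)) :=
    fun n ω => π (sampleMean fun i : Fin n => Y i ω) with hUdef
  have hUm : ∀ n, AEMeasurable (U n) μ := fun n => hπ.measurable.comp_aemeasurable (hmeanm n)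
  have hU : TendstoInMeasure μ U atTop fun _ => (0 : EuclideanSpace ℝ (Fin (p - 1))) := by
    refine tendstoInMeasure_of_tendsto_ae (fun n => (hUm n).aestronglyMeasurable) ?_
    filter_upwards [ae_tendsto_sample h hY hind] with ω hω
    have : π 0 = 0 := by
      ext k; simp [π]
    rw [← this]
    exact (hπ.tendsto 0).comp hω.1
  have hNU := hN.continuous_comp_prodMk_of_tendstoInMeasure_const
    (g := fun q : ℝ × EuclideanSpace ℝ (Fin (p - 1)) => -(q.1 • q.2)) (by fun_prop) hU hUm
  simp only [smul_zero, neg_zero] at hNU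
  have hNU' := tendstoInMeasure_zero_of_tendstoInDistribution hNU
  have hlim := tendstoInDistribution_of_tendstoInMeasure_sub
    (fun n ω => W n ω - N n ω • U n ω) id hW (by
      refine hNU'.congr (fun n => .of_forall fun ω => ?_) .rfl
      simp [sub_eq_add_neg])
    (fun n => by
      have := hW.forall_aemeasurable n
      have := hN.forall_aemeasurable n
      have := hUm n
      fun_prop)
  have hsq := hlim.continuous_comp (g := fun x => ‖x‖ ^ 2) (by fun_prop)
  have hfin := tendstoInDistribution_congr_law hsq (Z' := id) (μ'' := chiSquare (p - 1))
    aemeasurable_id (by rw [Measure.map_id, chiSquare_eq_map_stdGaussian]; rfl)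
  refine hfin.congr (fun n => .of_forall fun ω => ?_) .rfl
  simp only [Function.comp_apply]
  rw [EuclideanSpace.real_norm_sq_eq, residualSq, ← hesum, Finset.mul_sum, Finset.sum_div]
  refine Finset.sum_congr rfl fun k _ => ?_
  rcases Nat.eq_zero_or_pos n with rfl | hn
  · simp [hWdef, hNdef]
  have hn' : (0 : ℝ) < n := by exact_mod_cast hn
  have hkey : (W n ω - N n ω • U n ω) k
      = √n * inner ℝ (e k) ((sampleCov fun i : Fin n => Y i ω).toEuclideanLin θ₀) / √m := by
    have hs : √(n : ℝ) ≠ 0 := by positivity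
    have hsm : √m ≠ 0 := by positivity
    have hWk : W n ω k = (√n)⁻¹ * (∑ i : Fin n, inner ℝ (e k) (Y i ω) * inner ℝ θ₀ (Y i ω)) / √m := by
      rw [hWdef, Fin.sum_univ_eq_sum_range (fun i => inner ℝ (e k) (Y i ω) * inner ℝ θ₀ (Y i ω))]
      simp only [hg, PiLp.smul_apply, WithLp.ofLp_sum, Finset.sum_apply, smul_eq_mul]
      rw [mul_div_assoc, Finset.sum_div]
      congr 1
      exact Finset.sum_congr rfl fun i _ => by ring
    have hNn : N n ω = √n * inner ℝ θ₀ (sampleMean fun i : Fin n => Y i ω) := by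
      rw [inner_sampleMean, Fin.sum_univ_eq_sum_range (fun i => inner ℝ θ₀ (Y i ω)), hNdef]
      simp only
      rw [← mul_assoc]
      congr 1
      rw [← div_eq_mul_inv, Real.sqrt_div_self', one_div]
    have hinv : √(n : ℝ) * (n : ℝ)⁻¹ = (√n)⁻¹ := by
      rw [← div_eq_mul_inv, Real.sqrt_div_self', one_div]
    change W n ω k - N n ω * U n ω k = _
    rw [hWk, hNn, inner_sampleCov_eq_sub, ← hinv]
    simp only [hUdef, π]
    ring
  rw [hkey, div_pow, mul_pow, Real.sq_sqrt hn'.le, Real.sq_sqrt hm.le]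

end Sample

/-! ### The limit under spiked hypotheses -/

section Spiked

variable {p : ℕ} [NeZero p]

/-- A sequence of samples on one probability space, with the laws of the spiked samples, along which
the statistics converge. -/
theorem exists_spiked_samples {θ₀ : EuclideanSpace ℝ (Fin p)} (hθ₀ : ‖θ₀‖ = 1) {v : ℝ} (hv : 0 < v)
    {r : ℕ → ℝ} (hr_pos : ∀ n, 1 ≤ n → 0 < r n) (hr_bdd : ∃ C, ∀ n, 1 ≤ n → r n ≤ C)
    {f : ℝ → ℝ} (hf : IsRadialDensityFour p f) {m : ℝ}
    (hm : HasSphericalMoments (ellipticalMeasure (0 : EuclideanSpace ℝ (Fin p)) 1 f) m) :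
    ∃ (Ω : Type) (_ : MeasurableSpace Ω) (μ : Measure Ω) (_ : IsProbabilityMeasure μ)
      (x : ∀ n, Ω → Fin n → EuclideanSpace ℝ (Fin p)),
      (∀ n, HasLaw (x n)
        (Measure.pi fun _ => ellipticalMeasure 0 (spikedCov θ₀ (r n) v) f) μ) ∧
      (∀ n, ∀ᵐ x ∂(Measure.pi fun _ : Fin n => ellipticalMeasure 0 (spikedCov θ₀ (r n) v) f),
        (chosenEigensystem x).1 0 = 0 ∨
          ∀ j, j ≠ 0 → (chosenEigensystem x).1 j ≠ (chosenEigensystem x).1 0) ∧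
      TendstoInDistribution (fun n ω => qHPVSample θ₀ (x n ω) / (1 + kurtosisHat (x n ω))) atTop id
        (fun _ => μ) (chiSquare (p - 1)) ∧
      ∀ᵐ ω ∂μ, Tendsto (fun n => kurtosisHat (x n ω)) atTop (𝓝 (m - 1)) := by
  have := hf.isProbabilityMeasure
  set ν := ellipticalMeasure (0 : EuclideanSpace ℝ (Fin p)) 1 f with hν
  obtain ⟨Ω, mΩ, μ, Y, hYm, hY, hind, hμ⟩ := exists_iid ℕ ν
  obtain ⟨C, hC⟩ := hr_bdd
  set s : ℕ → ℝ := fun n => √(1 + r n * v) with hs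
  have hs1 : ∀ n, 1 ≤ n → 1 ≤ s n := fun n hn => by
    rw [hs, Real.one_le_sqrt]
    have := mul_pos (hr_pos n hn) hv
    linarith
  have hsq : ∀ n, 1 ≤ n → s n ^ 2 = 1 + r n * v := fun n hn =>
    Real.sq_sqrt (by have := mul_pos (hr_pos n hn) hv; linarith)
  set A : ℕ → EuclideanSpace ℝ (Fin p) → EuclideanSpace ℝ (Fin p) :=
    fun n => (spikedCov θ₀ 1 (s n - 1)).toEuclideanLin with hA
  have hAm : ∀ n, Measurable (A n) := fun n =>
    (LinearMap.continuous_of_finiteDimensional _).measurable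
  have hlaw : ∀ n, HasLaw (fun ω (i : Fin n) => A n (Y i ω)) (Measure.pi fun _ => ν.map (A n)) μ :=
    fun n => iIndepFun.hasLaw_pi
      (fun i => ⟨((hAm n).comp (hYm i)).aemeasurable, by
        rw [← (hY i).map_eq, Measure.map_map (hAm n) (hYm i)]; rfl⟩)
      ((hind.precomp Fin.val_injective).comp (fun _ => A n) fun _ => hAm n)
  have hpi : ∀ n, (fun _ : Fin n => ν.map (A n))
      = fun _ => ellipticalMeasure 0 (spikedCov θ₀ (r n) v) f := fun n => by
    funext i
    have hn : 1 ≤ n := i.pos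
    exact map_spiked_ellipticalMeasure_one hθ₀ (by linarith [hs1 n hn]) (hsq n hn) hf.measurable
  have hsimple : ∀ n, ∀ᵐ x ∂(Measure.pi fun _ : Fin n => ν.map (A n)),
      (chosenEigensystem x).1 0 = 0 ∨
        ∀ j, j ≠ 0 → (chosenEigensystem x).1 j ≠ (chosenEigensystem x).1 0 := fun n => by
    rcases Nat.eq_zero_or_pos n with rfl | hn
    · rw [show (fun _ : Fin 0 => ν.map (A 0)) = fun _ => ν from funext fun i => i.elim0]
      exact ae_largest_eigenvalue_simple (ellipticalMeasure_absolutelyContinuous _ _ _) 0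
    · have : IsProbabilityMeasure (ν.map (A n)) :=
        Measure.isProbabilityMeasure_map (hAm n).aemeasurable
      refine ae_largest_eigenvalue_simple ?_ n
      rw [congrFun (hpi n) ⟨0, hn⟩]
      exact ellipticalMeasure_absolutelyContinuous _ _ _
  have hsimple' := fun n =>
    ae_of_ae_map (hlaw n).aemeasurable ((hlaw n).map_eq.symm ▸ hsimple n)
  have key : ∀ᵐ ω ∂μ, Tendsto (fun n => kurtosisHat fun i : Fin n => A n (Y i ω)) atTop
        (𝓝 (m - 1)) ∧
      Tendsto (fun n : ℕ => (qHPVSample θ₀ (fun i : Fin n => A n (Y i ω))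
            / (1 + kurtosisHat fun i : Fin n => A n (Y i ω))
          - n * residualSq θ₀ (fun i : Fin n => Y i ω) / m)
        / (1 + |n * residualSq θ₀ (fun i : Fin n => Y i ω) / m|)) atTop (𝓝 0) := by
    filter_upwards [ae_tendsto_sample hm hY hind, ae_all_iff.2 hsimple'] with ω h1 h2
    have := tendsto_qHPVDagger_sub (y := fun i => Y i ω) (s := s) (K := 1 + C * v) hθ₀
      (by filter_upwards [eventually_ge_atTop 1] with n hn using hs1 n hn)
      (by
        filter_upwards [eventually_ge_atTop 1] with n hn
        rw [hsq n hn]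
        have := mul_le_mul_of_nonneg_right (hC n hn) hv.le
        linarith) hm.pos h1.1 h1.2.1 h1.2.2
      (fun n => isEigensystem_chosen fun i : Fin n => A n (Y i ω))
    have e : ∀ n, qHPVDagger θ₀ (fun i : Fin n => A n (Y i ω))
        (chosenEigensystem fun i : Fin n => A n (Y i ω)).1
        (chosenEigensystem fun i : Fin n => A n (Y i ω)).2
          = qHPVSample θ₀ (fun i : Fin n => A n (Y i ω))
            / (1 + kurtosisHat fun i : Fin n => A n (Y i ω)) := fun n => by
      rw [qHPVSample_eq (isEigensystem_chosen _) (h2 n), qHPVDagger]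
    refine ⟨this.1, ?_⟩
    simp_rw [← e]
    exact this.2
  have hW := tendstoInDistribution_residualSq hm hY hind hθ₀
  have hGm : ∀ n, AEMeasurable (fun ω => qHPVSample θ₀ (fun i : Fin n => A n (Y i ω))
      / (1 + kurtosisHat fun i : Fin n => A n (Y i ω))) μ := fun n =>
    ((measurable_qHPVSample θ₀).comp_aemeasurable (hlaw n).aemeasurable).div
      (aemeasurable_const.add (measurable_kurtosisHat.comp_aemeasurable (hlaw n).aemeasurable))
  have hB := tendstoInMeasure_zero_of_ratio hW (fun n => (hGm n).sub (hW.forall_aemeasurable n))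
    (key.mono fun ω h => h.2)
  refine ⟨Ω, mΩ, μ, hμ, fun n ω i => A n (Y i ω), fun n => hpi n ▸ hlaw n,
    fun n => hpi n ▸ hsimple n, ?_,
    key.mono fun ω h => h.1⟩
  exact tendstoInDistribution_of_tendstoInMeasure_sub _ id hW hB hGm

end Spiked

theorem tendsto_measureReal_zero_of_hasLaw {Ω' : Type*} {Ω : ℕ → Type*} {F : ℕ → Type*}
    [∀ n, MeasurableSpace (F n)] [∀ n, MeasurableSpace (Ω n)] {P : ∀ n, Measure (Ω n)}
    [MeasurableSpace Ω'] {μ : Measure Ω'} [IsFiniteMeasure μ] {ρ : ∀ n, Measure (F n)} {x : ∀ n, Ω' → F n}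
    {X : ∀ n, Ω n → F n} (hx : ∀ n, HasLaw (x n) (ρ n) μ) (hX : ∀ n, HasLaw (X n) (ρ n) (P n))
    {D : ∀ n, F n → ℝ} (hD : ∀ n, Measurable (D n))
    (h : TendstoInMeasure μ (fun n ω => D n (x n ω)) atTop 0) {ε : ℝ} (hε : 0 < ε) :
    Tendsto (fun n => (P n).real {ω | ε ≤ |D n (X n ω)|}) atTop (𝓝 0) := by
  refine (tendstoInMeasure_iff_measureReal_norm.1 h ε hε).congr fun n => ?_
  have hs : MeasurableSet {y | ε ≤ |D n y|} := measurableSet_le measurable_const (hD n).abs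
  rw [(hX n).measureReal_eq hs, ← (hx n).measureReal_eq hs]
  simp

end

theorem theorem5p1 {p : ℕ} [NeZero p] (hp : 2 ≤ p)
    (θ₀ : EuclideanSpace ℝ (Fin p)) (hθ₀ : ‖θ₀‖ = 1)
    (v : ℝ) (hv : 0 < v)
    (r : ℕ → ℝ) (hr_pos : ∀ n, 1 ≤ n → 0 < r n) (hr_bdd : ∃ C, ∀ n, 1 ≤ n → r n ≤ C)
    {Ω : ℕ → Type*} [∀ n, MeasurableSpace (Ω n)]
    (P : ∀ n, Measure (Ω n)) [∀ n, IsProbabilityMeasure (P n)]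
    (X : ∀ n, Fin n → Ω n → EuclideanSpace ℝ (Fin p))
    (lam : ∀ n, Ω n → Fin p → ℝ)
    (θ : ∀ n, Ω n → Fin p → EuclideanSpace ℝ (Fin p))
    (heig : ∀ n ω, IsEigensystem (sampleCov fun i => X n i ω) (lam n ω) (θ n ω)) :
    (∀ f : ℝ → ℝ, IsRadialDensityFour p f →
      (∀ n, IsRandomSample (P n) (X n) (ellipticalMeasure 0 (spikedCov θ₀ (r n) v) f)) →
        TendstoInDistribution
          (fun n ω => qHPVDagger θ₀ (fun i => X n i ω) (lam n ω) (θ n ω))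
          atTop id P (chiSquare (p - 1)) ∧
        ∀ α : ℝ, 0 < α → α < 1 →
          Tendsto
            (fun n => (P n).real {ω | chiSquareUpperQuantile (p - 1) α
              < qHPVDagger θ₀ (fun i => X n i ω) (lam n ω) (θ n ω)})
            atTop (𝓝 α)) ∧
    ((∀ n, IsRandomSample (P n) (X n)
        (ellipticalMeasure 0 (spikedCov θ₀ (r n) v) gaussianRadial)) →
      ∀ ε : ℝ, 0 < ε →
        Tendsto
          (fun n => (P n).real {ω | ε ≤
            |qHPVDagger θ₀ (fun i => X n i ω) (lam n ω) (θ n ω)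
              - qHPV θ₀ (fun i => X n i ω) (lam n ω) (θ n ω)|})
          atTop (𝓝 0)) := by
  have hlaw : ∀ f : ℝ → ℝ,
      (∀ n, IsRandomSample (P n) (X n) (ellipticalMeasure 0 (spikedCov θ₀ (r n) v) f)) → ∀ n,
      HasLaw (fun ω i => X n i ω)
        (Measure.pi fun _ => ellipticalMeasure 0 (spikedCov θ₀ (r n) v) f) (P n) :=
    fun f h n => iIndepFun.hasLaw_pi (h n).hasLaw (h n).indep
  refine ⟨fun f hf hX => ?_, fun hX ε hε => ?_⟩
  · obtain ⟨m, hm⟩ := hf.exists_hasSphericalMoments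
    obtain ⟨Ω', mΩ', μ, hμ, x, hx, hsimple, hlim, -⟩ :=
      exists_spiked_samples hθ₀ hv hr_pos hr_bdd hf hm
    have hXlaw := hlaw f hX
    have hT : TendstoInDistribution
        (fun n ω => qHPVDagger θ₀ (fun i => X n i ω) (lam n ω) (θ n ω))
        atTop id P (chiSquare (p - 1)) := by
      have hG : ∀ n, Measurable fun x : Fin n → EuclideanSpace ℝ (Fin p) =>
          qHPVSample θ₀ x / (1 + kurtosisHat x) := fun n =>
        (measurable_qHPVSample θ₀).div (measurable_const.add measurable_kurtosisHat)
      have hae : ∀ n, (fun ω => qHPVDagger θ₀ (fun i => X n i ω) (lam n ω) (θ n ω)) =ᵐ[P n]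
          fun ω => qHPVSample θ₀ (fun i => X n i ω) / (1 + kurtosisHat fun i => X n i ω) := fun n => by
        filter_upwards [ae_of_ae_map (hXlaw n).aemeasurable ((hXlaw n).map_eq.symm ▸ hsimple n)]
          with ω hω
        rw [qHPVDagger, qHPVSample_eq (heig n ω) hω]
      refine ⟨fun n => ((hG n).comp_aemeasurable (hXlaw n).aemeasurable).congr (hae n).symm,
        aemeasurable_id, ?_⟩
      refine hlim.tendsto.congr fun n => Subtype.ext ?_
      simp only
      rw [Measure.map_congr (hae n)]
      exact ((IdentDistrib.mk (hx n).aemeasurable (hXlaw n).aemeasurable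
        ((hx n).map_eq.trans (hXlaw n).map_eq.symm)).comp (hG n)).map_eq
    exact ⟨hT, fun α h0 h1 => tendsto_measure_quantile_lt (by omega) hT h0 h1⟩
  · have hf := isRadialDensityFour_gaussianRadial (p := p)
    obtain ⟨m, hm⟩ := hf.exists_hasSphericalMoments
    obtain rfl := eq_one_of_hasSphericalMoments_gaussianRadial hp hm
    obtain ⟨Ω', mΩ', μ, hμ, x, hx, hsimple, hlim, hκ⟩ :=
      exists_spiked_samples hθ₀ hv hr_pos hr_bdd hf hm
    have hXlaw := hlaw _ hX
    set D : ∀ n, (Fin n → EuclideanSpace ℝ (Fin p)) → ℝ := fun n x =>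
      qHPVSample θ₀ x / (1 + kurtosisHat x) - qHPVSample θ₀ x with hD
    have hDm : ∀ n, Measurable (D n) := fun n =>
      ((measurable_qHPVSample θ₀).div (measurable_const.add measurable_kurtosisHat)).sub
        (measurable_qHPVSample θ₀)
    have hmeas : TendstoInMeasure μ (fun n ω => D n (x n ω)) atTop 0 := by
      refine tendstoInMeasure_zero_of_ratio hlim
        (fun n => (hDm n).comp_aemeasurable (hx n).aemeasurable) ?_
      filter_upwards [hκ] with ω hω
      rw [sub_self] at hω
      refine squeeze_zero_norm' ?_ (tendsto_norm_zero.comp hω)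
      filter_upwards [hω.eventually (lt_mem_nhds (show (-1 : ℝ) < 0 by norm_num))] with n hn
      have hpos : 1 + kurtosisHat (x n ω) ≠ 0 := by linarith
      have e : D n (x n ω)
          = -(kurtosisHat (x n ω) * (qHPVSample θ₀ (x n ω) / (1 + kurtosisHat (x n ω)))) := by
        simp only [hD]
        field_simp
        ring
      rw [e, norm_div, norm_neg, norm_mul,
        Real.norm_of_nonneg (r := 1 + |qHPVSample θ₀ (x n ω) / (1 + kurtosisHat (x n ω))|)
          (by positivity), div_le_iff₀ (by positivity)]
      refine mul_le_mul_of_nonneg_left ?_ (norm_nonneg _)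
      rw [Real.norm_eq_abs]
      linarith
    refine (tendsto_measureReal_zero_of_hasLaw hx hXlaw hDm hmeas hε).congr fun n => ?_
    refine measureReal_congr ?_
    filter_upwards [ae_of_ae_map (hXlaw n).aemeasurable ((hXlaw n).map_eq.symm ▸ hsimple n)]
      with ω hω
    change (ε ≤ |qHPVSample θ₀ (fun i => X n i ω) / (1 + kurtosisHat fun i => X n i ω)
      - qHPVSample θ₀ fun i => X n i ω|) = _
    rw [qHPVSample_eq (heig n ω) hω]
    rfl
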